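/- Proposition 6 (Cost Heterogeneity). Consider a market with $n$ firms and a unit mass of consumers. Valuations are i.i.d. across consumers and products, with a distribution $F$ on $[0,1]$ that has a finite density, full support and mean $\mu$, and such that $F^{n-1}$ is weakly convex on $[0,1]$ for all sufficiently large $n$ (equivalently, for some $n\ge 2$). Upon being visited, and without observing the consumer's type or history, each firm chooses a distribution of the posterior mean that is a mean-preserving contraction (MPC) of $F$; it maximizes the probability of sale. A fraction $1-\alpha$ of consumers, $\alpha\in(0,1]$, is savvy and visits all firms. The others are inexperienced, with a privately known search cost per additional visit, distributed according to $K$; each visits at least one firm, searches sequentially in uniformly random order with free recall, and buys the best product among those visited. Let $s_1$ be the lowest cost in the support of $K$, with $0<s_1<\mu$, and let $K$ be either (a) discrete with finite support, or (b) absolutely continuous with a density $k$, supported on an interval $[s_1,s_k]$, with $k(s_1)>0$, where $k(s_1)$ is the right derivative of the distribution function of $K$ at $s_1$. An equilibrium is a pure-strategy symmetric perfect Bayesian equilibrium: every firm chooses the same $G\in\mathrm{MPC}(F)$; every cost type in the support of $K$ uses a stopping rule that is optimal after every history of observed posterior means, when every unvisited firm is expected to use $G$ (passive beliefs); and $G$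 maximizes $\int_0^1 u\,d\widehat G$ over $\widehat G\in \mathrm{MPC}(F)$, where $u(v)$ is the probability of sale of a visited firm with realized posterior mean $v$, given that rivals use $G$, the consumers' stopping rules, and the belief about the visitor's type derived by Bayes' rule. Then a finite $\underline n_K$ exists such that for every $n>\underline n_K$ there is an equilibrium $G$ with no disclosure at the bottom. That is, if $r$ is the reservation value of the lowest-cost type, $\int_r^1(v-r)\,dG=s_1$, then there are $\beta>0$ and $v_H\in(r,1]$, with $r>0$, such that $G(v_H)=F(v_H)$ and $$G(v)=\begin{cases}0 & v\in[0,r),\\ \min\{\beta(v-r),1\}^{\frac1{n-1}} & v\in[r,v_H],\\ F(v) & v\in(v_H,1].\end{cases}$$ -/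

import Mathlib

open MeasureTheory ProbabilityTheory Set

namespace SearchMarket

/-! ### Disclosure strategies -/

/-- `G ∈ MPC(F)`: `G` is a probability distribution on `[0, 1]` which is a mean-preserving
contraction of `F` (second-order stochastic dominance with equal means). -/
def IsMPC (G F : Measure ℝ) : Prop :=
  IsProbabilityMeasure G ∧ G (Icc 0 1)ᶜ = 0 ∧
    (∀ z ∈ Icc (0 : ℝ) 1, ∫ v in (0 : ℝ)..z, cdf G v ≤ ∫ v in (0 : ℝ)..z, cdf F v) ∧
    ∫ v in (0 : ℝ)..1, cdf G v = ∫ v in (0 : ℝ)..1, cdf F v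

/-- `r` solves the search equation `∫_r^1 (v - r) dG = s`. -/
def IsReservationValue (G : Measure ℝ) (s r : ℝ) : Prop :=
  ∫ v in Icc r 1, (v - r) ∂G = s

/-- The shape of a disclosure strategy `G` relative to the prior `F`, with `n` firms, reservation
value `r`, lower disclosure threshold `vL`, contact point `vH` and slope `β`. -/
structure HasDisclosureShape (F G : Measure ℝ) (n : ℕ) (r vL vH β : ℝ) : Prop where
  slope_pos : 0 < β
  lower_mem : vL ∈ Ico 0 r
  upper_mem : vH ∈ Ioc r 1
  contact : cdf G vH = cdf F vH
  below : ∀ v ∈ Icc 0 vL, cdf G v = cdf F v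
  gap : ∀ v ∈ Ioo vL r, cdf G v = cdf F vL
  affine : ∀ v ∈ Icc r vH,
    cdf G v = (min (cdf F vL ^ (n - 1) + β * (v - r)) 1) ^ (1 / ((n : ℝ) - 1))
  above : ∀ v ∈ Ioc vH 1, cdf G v = cdf F v

/-- No disclosure at the bottom: the lower disclosure threshold is `0`. -/
def NoDisclosureAtBottom (F G : Measure ℝ) (n : ℕ) (r : ℝ) : Prop :=
  ∃ vH β : ℝ, HasDisclosureShape F G n r 0 vH β

/-! ### Search -/

/-- A stopping rule: after the visits `0, …, t`, with the observed posterior means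
`h 0, …, h t` (in the order of the visits), it says whether the consumer stops. -/
abbrev StoppingRule : Type := (t : ℕ) → (Fin (t + 1) → ℝ) → Prop

/-- The rule that never stops voluntarily: all firms are visited. -/
def neverStop : StoppingRule := fun _ _ => False

/-- The largest posterior mean in a (non-empty) history. -/
noncomputable def best {t : ℕ} (h : Fin (t + 1) → ℝ) : ℝ :=
  Finset.univ.sup' Finset.univ_nonempty h

open Classical in
/-- Expected payoff, net of the search costs still to be paid, of a consumer with search cost `s`
who has observed the history `h`, has `m` unvisited firms left, follows `ρ` from now on, and
expects the posterior mean of every unvisited firm to be an independent draw from `G`. When she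
stops, or when no firm is left, she takes the best product seen so far (free recall). -/
noncomputable def searchPayoff (G : Measure ℝ) (s : ℝ) (ρ : StoppingRule) :
    (m : ℕ) → (t : ℕ) → (Fin (t + 1) → ℝ) → ℝ
  | 0, _, h => best h
  | m + 1, t, h =>
      if ρ t h then best h
      else (∫ v, searchPayoff G s ρ m (t + 1) (Fin.snoc h v : Fin (t + 1 + 1) → ℝ) ∂G) - s

/-- With `n` firms, `ρ` is optimal for search cost `s` after every history (on or off the path)
against every measurable stopping rule. -/
def IsOptimalSearch (n : ℕ) (G : Measure ℝ) (s : ℝ) (ρ : StoppingRule) : Prop :=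
  ∀ (m t : ℕ), t + 1 + m = n → ∀ h : Fin (t + 1) → ℝ, (∀ i, h i ∈ Icc (0 : ℝ) 1) →
    ∀ ρ' : StoppingRule, (∀ k, MeasurableSet {g : Fin (k + 1) → ℝ | ρ' k g}) →
      searchPayoff G s ρ' m t h ≤ searchPayoff G s ρ m t h

/-! ### Visits and sales
Below, `w j` is the posterior mean that the firm in position `j` of the consumer's search
order would generate. -/

/-- The firm in position `j` is visited: the consumer did not stop at any earlier position. -/
def Visited {n : ℕ} (ρ : StoppingRule) (w : Fin n → ℝ) (j : Fin n) : Prop :=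
  ∀ t : Fin n, t < j → ¬ ρ t (fun i : Fin ((t : ℕ) + 1) => w (Fin.castLE t.isLt i))

open Classical in
/-- Probability that the firm in position `j` makes the sale, given all posterior means: the
consumer buys a best product among the visited ones, ties being broken uniformly. -/
noncomputable def sale {n : ℕ} (ρ : StoppingRule) (w : Fin n → ℝ) (j : Fin n) : ℝ :=
  if Visited ρ w j ∧ ∀ i, Visited ρ w i → w i ≤ w j then
    1 / (Set.ncard {i | Visited ρ w i ∧ w i = w j} : ℝ)
  else 0

/-- Probability that a given firm is visited by a consumer who uses `ρ` and a uniformly random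
search order, when rivals' posterior means are independent draws from `G` (the firm's own draw is
irrelevant for this event). -/
noncomputable def visitProb (n : ℕ) (G : Measure ℝ) (ρ : StoppingRule) : ℝ :=
  (1 / (n : ℝ)) * ∑ j : Fin n, (Measure.pi fun _ : Fin n => G).real {w | Visited ρ w j}

/-- Probability that a given firm with realized posterior mean `v` is visited by, and sells to, a
consumer who uses `ρ` and a uniformly random search order, when rivals' posterior means are
independent draws from `G` (the coordinate `j` of the draw is overwritten by `v`). -/
noncomputable def saleProb (n : ℕ) (G : Measure ℝ) (ρ : StoppingRule) (v : ℝ) : ℝ :=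
  (1 / (n : ℝ)) *
    ∑ j : Fin n, ∫ w, sale ρ (Function.update w j v) j ∂(Measure.pi fun _ : Fin n => G)

/-! ### Equilibrium
A fraction `α` of the consumers is inexperienced, with search cost drawn from `K`, and type `s`
uses the stopping rule `σ s`; the other consumers are savvy and visit all firms. -/

/-- Probability of a visit by an inexperienced consumer. -/
noncomputable def eta (n : ℕ) (K G : Measure ℝ) (σ : ℝ → StoppingRule) : ℝ :=
  ∫ s, visitProb n G (σ s) ∂K

/-- Probability that a visitor is inexperienced, by Bayes' rule. -/
noncomputable def belief (n : ℕ) (α : ℝ) (K G : Measure ℝ) (σ : ℝ → StoppingRule) : ℝ :=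
  α * eta n K G σ / (α * eta n K G σ + (1 - α))

/-- Probability of a sale for a visited firm with realized posterior mean `v`:
`Pr(inexp | visit) * Pr(sale | visit, v, inexp) + Pr(savvy | visit) * Pr(sale | visit, v, savvy)`. -/
noncomputable def firmPayoff (n : ℕ) (α : ℝ) (K G : Measure ℝ) (σ : ℝ → StoppingRule) (v : ℝ) : ℝ :=
  belief n α K G σ * ((∫ s, saleProb n G (σ s) v ∂K) / eta n K G σ) +
    (1 - belief n α K G σ) * saleProb n G neverStop v

/-- Pure-strategy symmetric perfect Bayesian equilibrium (with passive beliefs and a uniformly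
random search order) of the market with `n` firms, prior `F`, a fraction `α` of inexperienced
consumers and search cost distribution `K`: every firm uses `G`, and the inexperienced consumer
with cost `s` uses the stopping rule `σ s`. -/
structure IsEquilibrium (n : ℕ) (F : Measure ℝ) (α : ℝ) (K G : Measure ℝ)
    (σ : ℝ → StoppingRule) : Prop where
  measurable_search : ∀ t : ℕ, MeasurableSet {p : ℝ × (Fin (t + 1) → ℝ) | σ p.1 t p.2}
  optimal_search : ∀ s ∈ K.support, IsOptimalSearch n G s (σ s)
  feasible : IsMPC G F
  optimal_disclosure : ∀ H : Measure ℝ, IsMPC H F →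
    ∫ v, firmPayoff n α K G σ v ∂H ≤ ∫ v, firmPayoff n α K G σ v ∂G

/-! ### Primitives -/

/-- The prior: a distribution with a finite density and full support on `[0, 1]`, for which
`F ^ (n - 1)` is convex on `[0, 1]` in all sufficiently large markets (as `F` is nonnegative and
increasing, convexity for one number `m ≥ 2` of firms gives it for all larger numbers). -/
structure IsPrior (F : Measure ℝ) : Prop where
  prob : IsProbabilityMeasure F
  density : ∃ f : ℝ → NNReal, Measurable f ∧ F = volume.withDensity fun v => (f v : ENNReal)
  support_eq : F.support = Icc 0 1
  convex_pow : ∃ m : ℕ, 2 ≤ m ∧ ConvexOn ℝ (Icc 0 1) fun v => cdf F v ^ (m - 1)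

/-- A discrete cost distribution: finite support, with smallest element `s₁`. -/
def IsDiscreteCost (K : Measure ℝ) (s₁ : ℝ) : Prop :=
  K.support.Finite ∧ IsLeast K.support s₁

/-- A continuous cost distribution: it has a density `k`, its support is an interval with smallest
element `s₁`, and the density at the lowest cost, that is, the right derivative of the
distribution function there, is positive. -/
def IsContinuousCost (K : Measure ℝ) (s₁ : ℝ) : Prop :=
  ∃ (k : ℝ → NNReal) (sk : ℝ), Measurable k ∧
    K = volume.withDensity (fun s => (k s : ENNReal)) ∧
    s₁ < sk ∧ K.support = Icc s₁ sk ∧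
    HasDerivWithinAt (cdf K) (k s₁ : ℝ) (Ici s₁) s₁ ∧ 0 < k s₁

end SearchMarket

/-!
If the firms offer a distribution `G` without mass below the reservation value `r` of the
lowest-cost type, then every inexperienced consumer buys at her first visit, and the search equation
for the lowest cost reads `r = μ - s₁`, with `μ` the mean of the prior `F`. With `r` known,
`G` is determined by its contact point `x` with `F`: its `(n - 1)`-st power is the chord from
`(r, 0)` to `(x, F(x)^(n-1))` on `[r, x]`, and `G = F` above. Equality of means becomes
`F(x) (x - r) (n - 1) / n = ∫₀ˣ F`, which the intermediate value theorem solves on `[r, x₀]` for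
large `n`, with a fixed `x₀ < 1` (`exists_contact`, `exists_isContact`). Convexity of `F^(n-1)`
makes the distribution functions of `G` and `F` cross only once on `[r, x]`, so `G` is a
mean-preserving contraction of `F` (`IsContact.isMPC`).

On the equilibrium path all rivals offer at least `r`. So stopping once the best product is worth
`μ - s` is optimal for every cost `s ≥ s₁` (`isOptimalSearch_cutoffRule`), and a visited firm with
posterior mean `v` sells with probability `b K(s ≥ μ - v) + (1 - b) G(v)^(n-1)`, where `b` is the
belief that the visitor is inexperienced (`firmPayoff_cutoffRule`).

Optimality of `G` follows from a convex price function `p` above this payoff `u`, equal to it on the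
support of `G`, and affine except where `G` and `F` coincide: for every contraction `H` of `F`,
`∫ u dH ≤ ∫ p dH ≤ ∫ p dF = ∫ p dG = ∫ u dG` (`IsContact.integral_le`). The middle step needs that
contractions lower integrals of convex functions (`IsMPC.integral_le_of_convexOn`). Above `r` the
price is `b + (1 - b) q` with `q` the chord up to `x` and `F^(n-1)` afterwards. Below `r` the chord
is continued, and `p ≥ u` holds if the slope `(1 - b) β` is at most `b` times a
constant `c` with `K(s < s₁ + y) ≥ c y`; such a constant exists in both cost models
(`IsDiscreteCost.exists_mul_le`, `IsContinuousCost.exists_mul_le`). Since `b` is at least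
of order `1 / n`, while `β` is at most a constant times `F(x₀)^(n-1)`, this holds for all large `n`.
-/

namespace SearchMarket

/-! ### Distribution functions on the unit interval -/

lemma cdf_eq_one_of_one_le {H : Measure ℝ} [IsProbabilityMeasure H] (hH : H (Icc 0 1)ᶜ = 0)
    {v : ℝ} (hv : 1 ≤ v) : cdf H v = 1 := by
  have h : ∀ᵐ x ∂H, x ∈ Icc (0 : ℝ) 1 := hH
  have h1 : H (Iic v) = 1 :=
    (mem_ae_iff_prob_eq_one measurableSet_Iic).1
      (by filter_upwards [h] with x hx using hx.2.trans hv)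
  rw [cdf_eq_real, measureReal_def, h1, ENNReal.toReal_one]

lemma continuous_cdf (H : Measure ℝ) [IsProbabilityMeasure H] [NullSingletonClass H] :
    Continuous (cdf H) := by
  refine continuous_iff_continuousAt.2 fun x => ?_
  rw [(monotone_cdf H).continuousAt_iff_leftLim_eq_rightLim, StieltjesFunction.rightLim_eq]
  have h : (cdf H).measure {x} = 0 := by rw [measure_cdf, measure_singleton]
  rw [StieltjesFunction.measure_singleton, ENNReal.ofReal_eq_zero] at h
  exact le_antisymm ((monotone_cdf H).leftLim_le le_rfl) (by linarith)

lemma integrable_of_continuousOn {H : Measure ℝ} [IsFiniteMeasure H] (hH : H (Icc 0 1)ᶜ = 0)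
    {f : ℝ → ℝ} (hf : ContinuousOn f (Icc 0 1)) : Integrable f H := by
  have h : H.restrict (Icc 0 1) = H := Measure.restrict_eq_self_of_ae_mem hH
  rw [← h]
  exact hf.integrableOn_compact isCompact_Icc

lemma integral_max_sub {H : Measure ℝ} [IsProbabilityMeasure H] (hH : H (Icc 0 1)ᶜ = 0)
    {z : ℝ} (hz : z ∈ Icc (0 : ℝ) 1) :
    ∫ v, max (v - z) 0 ∂H = ∫ t in z..1, (1 - cdf H t) := by
  have hint : Integrable (fun v => max (v - z) 0) H :=
    integrable_of_continuousOn hH (by fun_prop)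
  rw [hint.integral_eq_integral_meas_lt (ae_of_all _ fun v => le_max_right _ _)]
  have hset : ∀ t ∈ Ioi (0 : ℝ), H.real {v | t < max (v - z) 0} = 1 - cdf H (z + t) := by
    intro t ht
    have : {v : ℝ | t < max (v - z) 0} = (Iic (z + t))ᶜ := by
      ext v
      have h0 : ¬ t < 0 := not_lt.2 (le_of_lt ht)
      simp only [mem_ofPred_eq, lt_max_iff, h0, or_false, mem_compl_iff, mem_Iic, not_le]
      constructor <;> intro h <;> linarith
    rw [this, probReal_compl_eq_one_sub measurableSet_Iic, cdf_eq_real]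
  rw [setIntegral_congr_fun measurableSet_Ioi hset,
    setIntegral_eq_of_subset_of_forall_sdiff_eq_zero measurableSet_Ioi
      (s := Ioc 0 (1 - z)) (fun x hx => hx.1),
    ← intervalIntegral.integral_of_le (by linarith [hz.2]),
    intervalIntegral.integral_comp_add_left (fun t => 1 - cdf H t)]
  · simp
  · intro t ht
    have h1 : 1 ≤ z + t := by
      by_contra h
      exact ht.2 ⟨ht.1, by linarith⟩
    rw [cdf_eq_one_of_one_le hH h1, sub_self]

lemma intervalIntegrable_cdf (H : Measure ℝ) (a b : ℝ) :
    IntervalIntegrable (cdf H) volume a b := (monotone_cdf H).intervalIntegrable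

lemma integral_id_eq_one_sub {H : Measure ℝ} [IsProbabilityMeasure H] (hH : H (Icc 0 1)ᶜ = 0) :
    ∫ v, v ∂H = 1 - ∫ t in (0 : ℝ)..1, cdf H t := by
  have h := integral_max_sub hH (z := 0) (by simp)
  rw [intervalIntegral.integral_sub (by simp) (intervalIntegrable_cdf H _ _)] at h
  simp only [sub_zero, intervalIntegral.integral_const, smul_eq_mul, mul_one] at h
  rw [← h]
  refine integral_congr_ae ?_
  have hae : ∀ᵐ x ∂H, x ∈ Icc (0 : ℝ) 1 := hH
  filter_upwards [hae] with x hx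
  rw [max_eq_left hx.1]

/-! ### The convex order -/

/-- The piecewise linear interpolation of a continuous convex function on a fine uniform grid is a
nonnegative combination of call functions `v ↦ max (v - z) 0`, up to an affine function: the
coefficients are the second differences. -/
lemma exists_call_approx {ψ : ℝ → ℝ} (hc : ConvexOn ℝ (Icc 0 1) ψ)
    (hcont : ContinuousOn ψ (Icc 0 1)) {ε : ℝ} (hε : 0 < ε) :
    ∃ (M : ℕ) (a b : ℝ) (c z : ℕ → ℝ), (∀ k < M, 0 ≤ c k ∧ z k ∈ Icc (0 : ℝ) 1) ∧
      ∀ v ∈ Icc (0 : ℝ) 1,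
        |a + b * v + ∑ k ∈ Finset.range M, c k * max (v - z k) 0 - ψ v| ≤ ε := by
  have huc := isCompact_Icc.uniformContinuousOn_of_continuous hcont
  rw [Metric.uniformContinuousOn_iff] at huc
  obtain ⟨δ, hδ, huc⟩ := huc ε hε
  obtain ⟨M, hM⟩ := exists_nat_one_div_lt hδ
  set N : ℝ := (M : ℝ) + 1 with hN
  have hN0 : 0 < N := by positivity
  set p : ℕ → ℝ := fun k => (k : ℝ) / N with hp
  have hpsucc : ∀ k, p (k + 1) = p k + 1 / N := by
    intro k; simp only [hp]; push_cast; field_simp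
  have hpmem : ∀ k, k ≤ M + 1 → p k ∈ Icc (0 : ℝ) 1 := by
    intro k hk
    refine ⟨by positivity, ?_⟩
    rw [div_le_one hN0, hN]; exact_mod_cast hk
  set d : ℕ → ℝ := fun k => N * (ψ (p (k + 1)) - ψ (p k)) with hd
  have hline : ∀ j v, ψ (p 0) + d 0 * v + ∑ k ∈ Finset.range j, (d (k + 1) - d k) * (v - p (k + 1))
      = ψ (p j) + d j * (v - p j) := by
    intro j v
    induction j with
    | zero => simp [hp]
    | succ j ih =>
      rw [Finset.sum_range_succ, ← add_assoc, ih]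
      have : d j * (1 / N) = ψ (p (j + 1)) - ψ (p j) := by
        simp only [hd]; field_simp
      have h2 := hpsucc j
      have : d j * (p (j + 1) - p j) = ψ (p (j + 1)) - ψ (p j) := by
        rw [← this, h2]; ring
      linear_combination this
  refine ⟨M, ψ (p 0), d 0, fun k => d (k + 1) - d k, fun k => p (k + 1), ?_, ?_⟩
  · intro k hk
    refine ⟨?_, hpmem _ (by omega)⟩
    have h := hc.2 (hpmem k (by omega)) (hpmem (k + 1 + 1) (by omega))
      (by norm_num : (0 : ℝ) ≤ 1 / 2) (by norm_num : (0 : ℝ) ≤ 1 / 2) (by norm_num)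
    have he : (1 / 2 : ℝ) • p k + (1 / 2 : ℝ) • p (k + 1 + 1) = p (k + 1) := by
      simp only [smul_eq_mul, hpsucc]; ring
    rw [he] at h
    simp only [smul_eq_mul] at h
    simp only [hd]
    rw [← mul_sub]
    exact mul_nonneg hN0.le (by linarith)
  · intro v hv
    obtain ⟨j, hjM, hj1, hj2⟩ : ∃ j ≤ M, p j ≤ v ∧ v ≤ p (j + 1) := by
      rcases eq_or_lt_of_le hv.2 with h1 | h1
      · refine ⟨M, le_rfl, ?_, ?_⟩
        · rw [h1]; exact (hpmem M (by omega)).2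
        · rw [h1]; simp only [hp]; push_cast; rw [div_self hN0.ne']
      · have hNv : 0 ≤ N * v := mul_nonneg hN0.le hv.1
        refine ⟨⌊N * v⌋₊, ?_, ?_, ?_⟩
        · have : ⌊N * v⌋₊ < M + 1 := by
            rw [Nat.floor_lt hNv]; push_cast; nlinarith
          omega
        · simp only [hp]; rw [div_le_iff₀ hN0, mul_comm v]; exact Nat.floor_le hNv
        · simp only [hp]; rw [le_div_iff₀ hN0, mul_comm v]; push_cast
          exact (Nat.lt_floor_add_one _).le
    have hsum : ∑ k ∈ Finset.range M, (d (k + 1) - d k) * max (v - p (k + 1)) 0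
        = ∑ k ∈ Finset.range j, (d (k + 1) - d k) * (v - p (k + 1)) := by
      have hmono : Monotone p := fun a b h => by
        simp only [hp]; gcongr
      rw [← Finset.sum_subset (Finset.range_mono hjM)]
      · refine Finset.sum_congr rfl fun k hk => ?_
        have : p (k + 1) ≤ p j := hmono (by simpa using hk)
        rw [max_eq_left (by linarith)]
      · intro k _ hk
        have : p (j + 1) ≤ p (k + 1) := hmono (by simp at hk; omega)
        rw [max_eq_right (by linarith), mul_zero]
    rw [hsum, hline]
    -- The interpolation is a convex combination of two values of `ψ` that are `ε`-close to `ψ v`.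
    have hclose : ∀ i, i ≤ M + 1 → |p i - v| ≤ 1 / N → |ψ (p i) - ψ v| < ε := by
      intro i hi h
      have := huc (p i) (hpmem i hi) v hv (by rw [Real.dist_eq]; exact h.trans_lt hM)
      rwa [Real.dist_eq] at this
    have hs := hpsucc j
    have hA := hclose j (by omega) (by rw [abs_le]; constructor <;> linarith)
    have hB := hclose (j + 1) (by omega) (by rw [abs_le]; constructor <;> linarith)
    set θ : ℝ := N * (v - p j) with hθ
    have hθ0 : 0 ≤ θ := mul_nonneg hN0.le (by linarith)
    have hθ1 : θ ≤ 1 := by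
      have : N * (v - p j) ≤ N * (1 / N) := by gcongr; linarith
      rwa [mul_one_div_cancel hN0.ne'] at this
    have he : ψ (p j) + d j * (v - p j) - ψ v
        = (1 - θ) * (ψ (p j) - ψ v) + θ * (ψ (p (j + 1)) - ψ v) := by
      simp only [hd, hθ]; ring
    rw [he]
    rw [abs_lt] at hA hB
    rw [abs_le]
    constructor <;> nlinarith

/-- A mean-preserving contraction lowers the price of every call: integration by parts turns
`∫ max (v - z) 0 ∂G` into the integral of `1 - cdf G` over `[z, 1]`. -/
lemma IsMPC.integral_max_sub_le {F H : Measure ℝ} [IsProbabilityMeasure F]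
    (hF : F (Icc 0 1)ᶜ = 0) (hH : IsMPC H F) {z : ℝ} (hz : z ∈ Icc (0 : ℝ) 1) :
    ∫ v, max (v - z) 0 ∂H ≤ ∫ v, max (v - z) 0 ∂F := by
  obtain ⟨hp, h01, hle, heq⟩ := hH
  rw [integral_max_sub h01 hz, integral_max_sub hF hz,
    intervalIntegral.integral_sub (by simp) (intervalIntegrable_cdf H _ _),
    intervalIntegral.integral_sub (by simp) (intervalIntegrable_cdf F _ _)]
  have h1 := intervalIntegral.integral_add_adjacent_intervals
    (intervalIntegrable_cdf H 0 z) (intervalIntegrable_cdf H z 1)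
  have h2 := intervalIntegral.integral_add_adjacent_intervals
    (intervalIntegrable_cdf F 0 z) (intervalIntegrable_cdf F z 1)
  have := hle z hz
  linarith

lemma IsMPC.integral_id_eq {F H : Measure ℝ} [IsProbabilityMeasure F]
    (hF : F (Icc 0 1)ᶜ = 0) (hH : IsMPC H F) : ∫ v, v ∂H = ∫ v, v ∂F := by
  obtain ⟨hp, h01, hle, heq⟩ := hH
  rw [integral_id_eq_one_sub h01, integral_id_eq_one_sub hF, heq]

/-- Mean-preserving contractions are smaller in the convex order: calls approximate convex
functions. -/
lemma IsMPC.integral_le_of_convexOn {F H : Measure ℝ} [IsProbabilityMeasure F]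
    (hF : F (Icc 0 1)ᶜ = 0) (hH : IsMPC H F) {ψ : ℝ → ℝ} (hc : ConvexOn ℝ (Icc 0 1) ψ)
    (hcont : ContinuousOn ψ (Icc 0 1)) : ∫ v, ψ v ∂H ≤ ∫ v, ψ v ∂F := by
  refine le_of_forall_pos_le_add fun ε hε => ?_
  obtain ⟨M, a, b, c, z, hcz, happ⟩ := exists_call_approx hc hcont (half_pos hε)
  set q : ℝ → ℝ := fun v => a + b * v + ∑ k ∈ Finset.range M, c k * max (v - z k) 0 with hq
  have hqc : ContinuousOn q (Icc 0 1) := by fun_prop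
  have hint : ∀ {P : Measure ℝ} [IsProbabilityMeasure P], P (Icc 0 1)ᶜ = 0 →
      ∫ v, q v ∂P = a + b * ∫ v, v ∂P
        + ∑ k ∈ Finset.range M, c k * ∫ v, max (v - z k) 0 ∂P := by
    intro P _ hP
    simp only [hq]
    rw [integral_add, integral_add, integral_finsetSum]
    · simp [integral_const_mul b, integral_const_mul]
    · exact fun k _ => integrable_of_continuousOn hP (by fun_prop)
    all_goals exact integrable_of_continuousOn hP (by fun_prop)
  have hHp := hH.1
  have hH0 := hH.2.1
  have hclose : ∀ {P : Measure ℝ} [IsProbabilityMeasure P], P (Icc 0 1)ᶜ = 0 →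
      |∫ v, q v ∂P - ∫ v, ψ v ∂P| ≤ ε / 2 := by
    intro P _ hP
    rw [← integral_sub (integrable_of_continuousOn hP hqc) (integrable_of_continuousOn hP hcont)]
    have hae : ∀ᵐ x ∂P, x ∈ Icc (0 : ℝ) 1 := hP
    have := norm_integral_le_of_norm_le_const (μ := P) (f := fun v => q v - ψ v) (C := ε / 2)
      (by filter_upwards [hae] with x hx using happ x hx)
    simpa using this
  have h1 := abs_le.1 (hclose hH0)
  have h2 := abs_le.1 (hclose hF)
  have h3 : ∫ v, q v ∂H ≤ ∫ v, q v ∂F := by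
    rw [hint hH0, hint hF, hH.integral_id_eq hF]
    refine add_le_add le_rfl (Finset.sum_le_sum fun k hk => ?_)
    obtain ⟨h0, hz⟩ := hcz k (Finset.mem_range.1 hk)
    exact mul_le_mul_of_nonneg_left (hH.integral_max_sub_le hF hz) h0
  linarith

/-- Distributions whose distribution functions agree on `[x, ∞)` give the same integral to a
function that vanishes up to `x`. -/
lemma integral_eq_of_cdf_eq {F G : Measure ℝ} [IsProbabilityMeasure F] [IsProbabilityMeasure G]
    {x : ℝ} (h : ∀ v, x ≤ v → cdf G v = cdf F v) {ψ : ℝ → ℝ} (hψ : ∀ v ≤ x, ψ v = 0) :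
    ∫ v, ψ v ∂G = ∫ v, ψ v ∂F := by
  have hr : G.restrict (Ioi x) = F.restrict (Ioi x) := by
    refine Measure.ext_of_Iic _ _ fun a => ?_
    rw [Measure.restrict_apply measurableSet_Iic, Measure.restrict_apply measurableSet_Iic,
      inter_comm, Ioi_inter_Iic, ← measure_cdf G, ← measure_cdf F,
      StieltjesFunction.measure_Ioc, StieltjesFunction.measure_Ioc]
    rcases le_total x a with ha | ha
    · rw [h a ha, h x le_rfl]
    · rw [ENNReal.ofReal_of_nonpos (by linarith [monotone_cdf G ha]),
        ENNReal.ofReal_of_nonpos (by linarith [monotone_cdf F ha])]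
  have hz : ∀ v, v ∉ Ioi x → ψ v = 0 := fun v hv => hψ v (not_lt.1 hv)
  rw [← setIntegral_eq_integral_of_forall_compl_eq_zero hz, hr,
    setIntegral_eq_integral_of_forall_compl_eq_zero hz]

/-! ### Search when every product is worth stopping for -/

/-- The stopping rules of all cost types: the consumer with cost `s` stops as soon as the best
product seen is worth at least her reservation value `m - s`, where `m` is the mean of the
distribution offered by the firms. -/
noncomputable def cutoffRule (m s : ℝ) : StoppingRule := fun _ h => m ≤ s + best h

lemma le_best {t : ℕ} (h : Fin (t + 1) → ℝ) (i : Fin (t + 1)) : h i ≤ best h :=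
  Finset.le_sup' h (Finset.mem_univ i)

lemma best_snoc {t : ℕ} (h : Fin (t + 1) → ℝ) (v : ℝ) :
    best (Fin.snoc h v : Fin (t + 1 + 1) → ℝ) = max (best h) v := by
  refine le_antisymm (Finset.sup'_le _ _ fun i _ => ?_)
    (max_le (Finset.sup'_le _ _ fun i _ => ?_) ?_)
  · induction i using Fin.lastCases with
    | last => simp
    | cast i => simpa using Or.inl (le_best h i)
  · simpa using le_best (Fin.snoc h v : Fin (t + 1 + 1) → ℝ) i.castSucc
  · simpa using le_best (Fin.snoc h v : Fin (t + 1 + 1) → ℝ) (Fin.last _)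

lemma measurableSet_cutoffRule (m : ℝ) (t : ℕ) :
    MeasurableSet {p : ℝ × (Fin (t + 1) → ℝ) | cutoffRule m p.1 t p.2} := by
  have hb : Measurable fun p : ℝ × (Fin (t + 1) → ℝ) => best p.2 := by
    have := Finset.measurable_sup' (s := (Finset.univ : Finset (Fin (t + 1))))
      Finset.univ_nonempty (f := fun i (p : ℝ × (Fin (t + 1) → ℝ)) => p.2 i)
      (fun i _ => by fun_prop)
    convert this using 1
    ext p
    simp [best, Finset.sup'_apply]
  exact measurableSet_le measurable_const (measurable_fst.add hb)

lemma searchPayoff_cutoffRule_of_le {G : Measure ℝ} {m s : ℝ} {t : ℕ}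
    {h : Fin (t + 1) → ℝ} (hh : m ≤ s + best h) (k : ℕ) :
    searchPayoff G s (cutoffRule m s) k t h = best h := by
  cases k with
  | zero => rfl
  | succ k =>
    have hc : cutoffRule m s t h := hh
    rw [searchPayoff, if_pos hc]

section Search

variable {G : Measure ℝ} {r m s : ℝ}

/-- No rule does better than the larger of the best product seen and the reservation value. If the
continuation payoff is not integrable, its integral is `0` and the bound holds anyway. -/
lemma searchPayoff_le [IsProbabilityMeasure G] (hG : ∀ᵐ v ∂G, v ∈ Icc r 1) (hm : ∫ v, v ∂G = m)
    (hs : 0 ≤ s) (hsr : m ≤ s + r) (ρ : StoppingRule) :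
    ∀ (k t : ℕ) (h : Fin (t + 1) → ℝ), 0 ≤ best h →
      searchPayoff G s ρ k t h ≤ max (best h) (m - s) := by
  have hint : Integrable (fun v : ℝ => v) G :=
    Integrable.of_mem_Icc r 1 (by fun_prop) hG
  intro k
  induction k with
  | zero => intro t h _; exact le_max_left _ _
  | succ k ih =>
    intro t h h0
    rw [searchPayoff]
    split_ifs
    · exact le_max_left _ _
    by_cases hi : Integrable (fun v => searchPayoff G s ρ k (t + 1) (Fin.snoc h v)) G
    · have hle : ∫ v, searchPayoff G s ρ k (t + 1) (Fin.snoc h v) ∂G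
          ≤ ∫ v, (v + max (best h - (m - s)) 0) ∂G := by
        refine integral_mono_ae hi (hint.add (integrable_const _)) ?_
        filter_upwards [hG] with v hv
        refine (ih (t + 1) (Fin.snoc h v) ?_).trans ?_
        · rw [best_snoc]; exact h0.trans (le_max_left _ _)
        · rw [best_snoc]
          have h1 := le_max_left (best h - (m - s)) 0
          have h2 := le_max_right (best h - (m - s)) 0
          have h3 := hv.1
          refine max_le (max_le ?_ ?_) ?_ <;> linarith
      rw [integral_add hint (integrable_const _), hm] at hle
      simp only [integral_const, probReal_univ, one_smul] at hle
      rcases le_total (best h) (m - s) with h1 | h1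
      · rw [max_eq_right (by linarith)] at hle
        rw [max_eq_right h1]; linarith
      · rw [max_eq_left (by linarith)] at hle
        rw [max_eq_left h1]; linarith
    · rw [integral_undef hi]
      exact le_max_of_le_left (by linarith)

lemma searchPayoff_cutoffRule (hG : ∀ᵐ v ∂G, v ∈ Icc r 1) (hm : ∫ v, v ∂G = m)
    (hsr : m ≤ s + r) (k t : ℕ) (h : Fin (t + 1) → ℝ) :
    searchPayoff G s (cutoffRule m s) (k + 1) t h = max (best h) (m - s) := by
  by_cases hh : m ≤ s + best h
  · rw [searchPayoff_cutoffRule_of_le hh, max_eq_left (by linarith)]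
  · have hn : ¬ cutoffRule m s t h := hh
    have heq : ∫ v, searchPayoff G s (cutoffRule m s) k (t + 1) (Fin.snoc h v) ∂G
        = ∫ v, v ∂G := by
      refine integral_congr_ae ?_
      filter_upwards [hG] with v hv
      have hb : best (Fin.snoc h v : Fin (t + 1 + 1) → ℝ) = v := by
        rw [best_snoc, max_eq_right]; linarith [hv.1]
      rw [searchPayoff_cutoffRule_of_le, hb]
      rw [hb]; linarith [hv.1]
    rw [searchPayoff, if_neg hn, heq, hm, max_eq_right (by linarith)]

lemma isOptimalSearch_cutoffRule [IsProbabilityMeasure G] (hG : ∀ᵐ v ∂G, v ∈ Icc r 1)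
    (hm : ∫ v, v ∂G = m) (hs : 0 ≤ s) (hsr : m ≤ s + r) (n : ℕ) :
    IsOptimalSearch n G s (cutoffRule m s) := by
  intro k t _ h hh ρ _
  cases k with
  | zero => exact le_rfl
  | succ k =>
    rw [searchPayoff_cutoffRule hG hm hsr]
    exact searchPayoff_le hG hm hs hsr ρ _ t h ((hh 0).1.trans (le_best h 0))

end Search

/-! ### Visits and sales -/

section Sales

variable {n : ℕ}

lemma visited_cutoffRule_iff {m s : ℝ} {w : Fin n → ℝ} (hn : 0 < n) (hw : m ≤ s + w ⟨0, hn⟩)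
    (j : Fin n) : Visited (cutoffRule m s) w j ↔ j = ⟨0, hn⟩ := by
  constructor
  · intro h
    by_contra hj
    have hlt : (⟨0, hn⟩ : Fin n) < j := by
      rw [Fin.lt_def]
      exact Nat.pos_of_ne_zero fun h0 => hj (Fin.ext h0)
    refine h ⟨0, hn⟩ hlt ?_
    have := le_best (fun i : Fin (0 + 1) => w (Fin.castLE hn i)) 0
    exact hw.trans (by gcongr; exact this)
  · rintro rfl t ht
    exact absurd ht (by simp [Fin.lt_def])

lemma visited_cutoffRule_second {m s : ℝ} {w : Fin n → ℝ} (hn : 2 ≤ n)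
    (hw : s + w ⟨0, by omega⟩ < m) : Visited (cutoffRule m s) w ⟨1, hn⟩ := by
  rintro ⟨t, ht⟩ hlt
  obtain rfl : t = 0 := by simpa [Fin.lt_def] using hlt
  intro h
  have hb : best (fun i : Fin (0 + 1) => w (Fin.castLE ht i)) ≤ w ⟨0, by omega⟩ := by
    refine Finset.sup'_le _ _ fun i _ => ?_
    rw [Fin.fin_one_eq_zero i]
    exact le_rfl
  have h' : m ≤ s + best (fun i : Fin (0 + 1) => w (Fin.castLE ht i)) := h
  linarith

variable {G : Measure ℝ} [IsProbabilityMeasure G] {r m s : ℝ}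

lemma ae_pi_forall {p : ℝ → Prop} (h : ∀ᵐ v ∂G, p v) :
    ∀ᵐ w ∂(Measure.pi fun _ : Fin n => G), ∀ i, p (w i) :=
  ae_all_iff.2 fun i =>
    (Measure.quasiMeasurePreserving_eval (fun _ : Fin n => G) i).ae h

/-- All products are worth at least `r`, so a type with reservation value at most `r` buys from
the first firm she visits. -/
lemma visitProb_cutoffRule (hn : 0 < n) (hG : ∀ᵐ v ∂G, v ∈ Icc r 1) (hsr : m ≤ s + r) :
    visitProb n G (cutoffRule m s) = 1 / n := by
  have h : ∀ j : Fin n, (Measure.pi fun _ : Fin n => G).real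
      {w | Visited (cutoffRule m s) w j} = if j = ⟨0, hn⟩ then 1 else 0 := by
    intro j
    have hae : ∀ᵐ w ∂(Measure.pi fun _ : Fin n => G),
        (Visited (cutoffRule m s) w j ↔ j = ⟨0, hn⟩) := by
      filter_upwards [ae_pi_forall (n := n) hG] with w hw
      exact visited_cutoffRule_iff hn (by linarith [(hw ⟨0, hn⟩).1]) j
    have hc : {w | Visited (cutoffRule m s) w j} =ᵐ[Measure.pi fun _ : Fin n => G]
        {_w | j = ⟨0, hn⟩} := by
      filter_upwards [hae] with w hw using propext hw
    rw [measureReal_congr hc]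
    split_ifs with hj <;> simp [hj]
  rw [visitProb, Finset.sum_congr rfl fun j _ => h j]
  simp

/-- Off the path a product `v < r` is sold only to a first-time visitor whose reservation value is
at most `v`: any other visitor goes on to a firm that offers at least `r`. -/
lemma saleProb_cutoffRule (hn : 2 ≤ n) (hG : ∀ᵐ v ∂G, v ∈ Icc r 1) (hsr : m ≤ s + r) (v : ℝ) :
    saleProb n G (cutoffRule m s) v = if m ≤ s + v then 1 / (n : ℝ) else 0 := by
  have hn0 : 0 < n := by omega
  have h : ∀ j : Fin n, ∫ w, sale (cutoffRule m s) (Function.update w j v) j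
      ∂(Measure.pi fun _ : Fin n => G) = if j = ⟨0, hn0⟩ ∧ m ≤ s + v then 1 else 0 := by
    intro j
    have hae : ∀ᵐ w ∂(Measure.pi fun _ : Fin n => G),
        sale (cutoffRule m s) (Function.update w j v) j
          = if j = ⟨0, hn0⟩ ∧ m ≤ s + v then 1 else 0 := by
      filter_upwards [ae_pi_forall (n := n) hG] with w hw
      by_cases hj : j = ⟨0, hn0⟩
      · subst hj
        by_cases hv : m ≤ s + v
        · have hvis := visited_cutoffRule_iff (w := Function.update w ⟨0, hn0⟩ v) hn0
            (by simpa using hv)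
          have hset : {i | i = (⟨0, hn0⟩ : Fin n) ∧ Function.update w ⟨0, hn0⟩ v i
              = Function.update w ⟨0, hn0⟩ v ⟨0, hn0⟩} = {⟨0, hn0⟩} := by
            ext i
            simp only [mem_ofPred_eq, mem_singleton_iff, and_iff_left_iff_imp]
            rintro rfl
            rfl
          simp only [sale, hvis]
          rw [hset]
          simp [hv]
        · have hvis := visited_cutoffRule_second (w := Function.update w ⟨0, hn0⟩ v) hn
            (by simpa using hv)
          have h1 : (⟨1, hn⟩ : Fin n) ≠ ⟨0, hn0⟩ := by simp
          rw [sale, if_neg, if_neg (by simp [hv])]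
          rintro ⟨-, hbest⟩
          have := hbest _ hvis
          rw [Function.update_of_ne h1, Function.update_self] at this
          linarith [(hw ⟨1, hn⟩).1]
      · rw [sale, if_neg, if_neg (by simp [hj])]
        rintro ⟨hvis, -⟩
        refine hj ((visited_cutoffRule_iff hn0 ?_ j).1 hvis)
        rw [Function.update_of_ne (Ne.symm hj)]
        linarith [(hw ⟨0, hn0⟩).1]
    rw [integral_congr_ae hae]
    simp
  rw [saleProb, Finset.sum_congr rfl fun j _ => h j]
  by_cases hv : m ≤ s + v <;> simp [hv]

/-- A savvy visitor buys from a firm if and only if it has the best product; ties have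
probability zero, as `G` has no atoms. -/
lemma saleProb_neverStop [NullSingletonClass G] (hn : 0 < n) (v : ℝ) :
    saleProb n G neverStop v = cdf G v ^ (n - 1) := by
  have h : ∀ j : Fin n, ∫ w, sale neverStop (Function.update w j v) j
      ∂(Measure.pi fun _ : Fin n => G) = cdf G v ^ (n - 1) := by
    intro j
    have hne : ∀ᵐ x ∂G, x ≠ v := by
      rw [ae_iff]; simp
    set S : Set (Fin n → ℝ) := univ.pi fun i => if i = j then univ else Iic v with hS
    have hSm : MeasurableSet S := by
      refine MeasurableSet.univ_pi fun i => ?_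
      split_ifs
      · exact MeasurableSet.univ
      · exact measurableSet_Iic
    have hae : ∀ᵐ w ∂(Measure.pi fun _ : Fin n => G),
        sale neverStop (Function.update w j v) j = S.indicator 1 w := by
      filter_upwards [ae_pi_forall (n := n) hne] with w hw
      have hvis : ∀ i, Visited neverStop (Function.update w j v) i := fun i t _ => id
      have hset : {i | Function.update w j v i = v} = {j} := by
        ext i
        by_cases hi : i = j
        · simp [hi]
        · simp [hi, hw i]
      have hmem : w ∈ S ↔ ∀ i, Function.update w j v i ≤ v := by
        simp only [hS, mem_univ_pi]
        refine forall_congr' fun i => ?_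
        by_cases hi : i = j
        · subst hi; simp
        · simp [hi]
      simp only [sale, hvis, true_and, forall_true_left, Function.update_self, hset,
        ncard_singleton, indicator, hmem]
      simp
    rw [integral_congr_ae hae, integral_indicator_one hSm, measureReal_def, hS, Measure.pi_pi,
      ← Finset.mul_prod_erase _ _ (Finset.mem_univ j), if_pos rfl, measure_univ, one_mul,
      Finset.prod_congr rfl (g := fun _ => G (Iic v)), Finset.prod_const,
      Finset.card_erase_of_mem (Finset.mem_univ j), Finset.card_univ, Fintype.card_fin,
      ENNReal.toReal_pow, ← measureReal_def, cdf_eq_real]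
    intro i hi
    rw [if_neg (Finset.ne_of_mem_erase hi)]
  rw [saleProb, Finset.sum_congr rfl fun j _ => h j]
  have : (n : ℝ) ≠ 0 := by positivity
  simp [this]

variable {K : Measure ℝ} [IsProbabilityMeasure K]

lemma eta_cutoffRule (hn : 0 < n) (hG : ∀ᵐ v ∂G, v ∈ Icc r 1) (hK : ∀ᵐ s ∂K, m ≤ s + r) :
    eta n K G (cutoffRule m) = 1 / n := by
  rw [eta, integral_congr_ae (g := fun _ => 1 / (n : ℝ))]
  · simp
  · filter_upwards [hK] with s hs using visitProb_cutoffRule hn hG hs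

/-- The probability of a sale: the inexperienced visitor, who is met with probability `b`, buys if
her reservation value is at most `v`, and the savvy one if `v` beats all rivals. -/
lemma firmPayoff_cutoffRule [NullSingletonClass G] (hn : 2 ≤ n) (hG : ∀ᵐ v ∂G, v ∈ Icc r 1)
    (hK : ∀ᵐ s ∂K, m ≤ s + r) (α : ℝ) (v : ℝ) :
    firmPayoff n α K G (cutoffRule m) v
      = belief n α K G (cutoffRule m) * (1 - K.real (Iio (m - v)))
        + (1 - belief n α K G (cutoffRule m)) * cdf G v ^ (n - 1) := by
  have hn0 : (n : ℝ) ≠ 0 := by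
    have : 0 < n := by omega
    positivity
  have h : ∫ s, saleProb n G (cutoffRule m s) v ∂K = (1 - K.real (Iio (m - v))) * (1 / n) := by
    rw [integral_congr_ae (g := (Ici (m - v)).indicator fun _ => 1 / (n : ℝ))]
    · rw [integral_indicator_const _ measurableSet_Ici, ← compl_Iio,
        probReal_compl_eq_one_sub measurableSet_Iio, smul_eq_mul]
    · filter_upwards [hK] with s hs
      rw [saleProb_cutoffRule hn hG hs]
      have : m ≤ s + v ↔ s ∈ Ici (m - v) := by rw [mem_Ici, sub_le_iff_le_add]
      simp only [this, indicator]
  rw [firmPayoff, h, eta_cutoffRule (by omega) hG hK, saleProb_neverStop (by omega),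
    mul_div_cancel_right₀ _ (by positivity)]

end Sales

/-! ### The disclosure strategy -/

/-- The distribution function with no mass below `r`, with an affine `(n - 1)`-st power on
`[r, x]`, and equal to that of the prior `F` above `x`. -/
noncomputable def disclosureFun (F : Measure ℝ) (n : ℕ) (r x v : ℝ) : ℝ :=
  if v ≤ x then cdf F x * (max 0 ((v - r) / (x - r))) ^ (1 / ((n : ℝ) - 1)) else cdf F v

section DisclosureFun

variable {F : Measure ℝ} {n : ℕ} {r x v : ℝ}

lemma sub_one_pos_of_two_le (hn : 2 ≤ n) : (0 : ℝ) < n - 1 := by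
  have : (2 : ℝ) ≤ n := by exact_mod_cast hn
  linarith

lemma disclosureFun_of_le (hn : 2 ≤ n) (hrx : r < x) (hv : v ≤ r) :
    disclosureFun F n r x v = 0 := by
  have h := sub_one_pos_of_two_le hn
  rw [disclosureFun, if_pos (hv.trans hrx.le), max_eq_left, Real.zero_rpow (by positivity),
    mul_zero]
  exact div_nonpos_of_nonpos_of_nonneg (by linarith) (by linarith)

lemma disclosureFun_of_ge (hrx : r < x) (hv : x ≤ v) :
    disclosureFun F n r x v = cdf F v := by
  rcases hv.eq_or_lt with rfl | h
  · rw [disclosureFun, if_pos le_rfl, div_self (by linarith), max_eq_right zero_le_one,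
      Real.one_rpow, mul_one]
  · rw [disclosureFun, if_neg (not_le.2 h)]

lemma disclosureFun_of_mem (hrx : r < x) (hv : v ∈ Icc r x) :
    disclosureFun F n r x v = cdf F x * ((v - r) / (x - r)) ^ (1 / ((n : ℝ) - 1)) := by
  rw [disclosureFun, if_pos hv.2, max_eq_right]
  exact div_nonneg (by linarith [hv.1]) (by linarith)

lemma disclosureFun_eq_rpow (hn : 2 ≤ n) (hrx : r < x) (hv : v ∈ Icc r x) :
    disclosureFun F n r x v
      = (cdf F x ^ (n - 1) / (x - r) * (v - r)) ^ (1 / ((n : ℝ) - 1)) := by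
  have h := sub_one_pos_of_two_le hn
  have hF := cdf_nonneg F x
  have hq : 0 ≤ (v - r) / (x - r) := div_nonneg (by linarith [hv.1]) (by linarith)
  have hcast : ((n - 1 : ℕ) : ℝ) = (n : ℝ) - 1 := by
    rw [Nat.cast_sub (by omega), Nat.cast_one]
  rw [disclosureFun_of_mem hrx hv, div_mul_eq_mul_div, mul_div_assoc,
    Real.mul_rpow (by positivity) hq, one_div, ← hcast, Real.pow_rpow_inv_natCast hF (by omega)]

lemma continuous_disclosureFun [IsProbabilityMeasure F] [NullSingletonClass F] (hn : 2 ≤ n)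
    (hrx : r < x) : Continuous (disclosureFun F n r x) := by
  have h := sub_one_pos_of_two_le hn
  refine Continuous.if_le ?_ (continuous_cdf F) continuous_id continuous_const ?_
  · refine continuous_const.mul (Continuous.rpow_const (by fun_prop) fun _ => Or.inr ?_)
    positivity
  · rintro v rfl
    rw [div_self (by linarith), max_eq_right zero_le_one, Real.one_rpow, mul_one]

lemma monotone_disclosureFun (hn : 2 ≤ n) (hrx : r < x) : Monotone (disclosureFun F n r x) := by
  have h := sub_one_pos_of_two_le hn
  have hle : ∀ u v, u ≤ v → v ≤ x → disclosureFun F n r x u ≤ disclosureFun F n r x v := by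
    intro u v huv hv
    rw [disclosureFun, disclosureFun, if_pos (huv.trans hv), if_pos hv]
    have hF := cdf_nonneg F x
    gcongr
  intro u v huv
  rcases le_total v x with hv | hv
  · exact hle u v huv hv
  · rcases le_total u x with hu | hu
    · refine (hle u x hu le_rfl).trans ?_
      rw [disclosureFun_of_ge hrx le_rfl, disclosureFun_of_ge hrx hv]
      exact monotone_cdf F hv
    · rw [disclosureFun_of_ge hrx hu, disclosureFun_of_ge hrx hv]
      exact monotone_cdf F huv

lemma integral_disclosureFun [IsProbabilityMeasure F] [NullSingletonClass F] (hn : 2 ≤ n)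
    (hr : 0 ≤ r) (hrx : r < x) (hx : x ≤ 1) :
    ∫ v in (0 : ℝ)..1, disclosureFun F n r x v
      = cdf F x * (x - r) * ((n - 1) / n) + ∫ v in x..1, cdf F v := by
  have h := sub_one_pos_of_two_le hn
  have hint : ∀ a b, IntervalIntegrable (disclosureFun F n r x) volume a b :=
    fun a b => (continuous_disclosureFun hn hrx).intervalIntegrable a b
  rw [← intervalIntegral.integral_add_adjacent_intervals (hint 0 r) (hint r 1),
    ← intervalIntegral.integral_add_adjacent_intervals (hint r x) (hint x 1)]
  have h1 : ∫ v in (0 : ℝ)..r, disclosureFun F n r x v = ∫ v in (0 : ℝ)..r, (0 : ℝ) := by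
    refine intervalIntegral.integral_congr fun v hv => ?_
    rw [uIcc_of_le hr] at hv
    exact disclosureFun_of_le hn hrx hv.2
  have h2 : ∫ v in x..1, disclosureFun F n r x v = ∫ v in x..1, cdf F v := by
    refine intervalIntegral.integral_congr fun v hv => ?_
    rw [uIcc_of_le hx] at hv
    exact disclosureFun_of_ge hrx hv.1
  have h3 : ∫ v in r..x, disclosureFun F n r x v
      = ∫ v in r..x, cdf F x * (v / (x - r) - r / (x - r)) ^ (1 / ((n : ℝ) - 1)) := by
    refine intervalIntegral.integral_congr fun v hv => ?_
    rw [uIcc_of_le hrx.le] at hv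
    simp only [disclosureFun_of_mem hrx hv, sub_div]
  have hxr : x - r ≠ 0 := by linarith
  have h4 : (1 : ℝ) / (n - 1) + 1 = n / (n - 1) := by field_simp; ring
  have hn0 : (n : ℝ) ≠ 0 := by linarith
  rw [h1, h2, h3, intervalIntegral.integral_const_mul,
    intervalIntegral.integral_comp_div_sub (fun v => v ^ (1 / ((n : ℝ) - 1))) hxr,
    sub_self, ← sub_div, div_self hxr,
    integral_rpow (Or.inl (by have : 0 < 1 / ((n : ℝ) - 1) := by positivity
                              linarith)), h4, Real.one_rpow,
    Real.zero_rpow (by positivity)]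
  simp only [intervalIntegral.integral_zero, smul_eq_mul]
  field_simp
  ring

end DisclosureFun

lemma exists_measure_cdf_eq {g : ℝ → ℝ} (hg : Monotone g) (hc : Continuous g)
    {a b : ℝ} (ha : ∀ v ≤ a, g v = 0) (hb : ∀ v, b ≤ v → g v = 1) :
    ∃ G : Measure ℝ, IsProbabilityMeasure G ∧ NullSingletonClass G ∧ ∀ v, cdf G v = g v := by
  let f : StieltjesFunction ℝ := ⟨g, hg, fun x => hc.continuousWithinAt⟩
  have h0 : Filter.Tendsto f Filter.atBot (nhds 0) :=
    tendsto_const_nhds.congr' ((Filter.eventually_le_atBot a).mono fun v hv => (ha v hv).symm)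
  have h1 : Filter.Tendsto f Filter.atTop (nhds 1) :=
    tendsto_const_nhds.congr' ((Filter.eventually_ge_atTop b).mono fun v hv => (hb v hv).symm)
  refine ⟨f.measure, ⟨by rw [f.measure_univ h0 h1, sub_zero, ENNReal.ofReal_one]⟩,
    ⟨fun v => ?_⟩, fun v => by rw [cdf_measure_stieltjesFunction f h0 h1]⟩
  have hl : Function.leftLim f v = f v := hc.continuousWithinAt.leftLim_eq
  rw [StieltjesFunction.measure_singleton, hl, sub_self, ENNReal.ofReal_zero]

/-! ### Convexity of the powers of the prior -/

lemma convexOn_cdf_pow_of_le {F : Measure ℝ} {m n : ℕ} (hm : 2 ≤ m) (hmn : m ≤ n)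
    (h : ConvexOn ℝ (Icc 0 1) fun v => cdf F v ^ (m - 1)) :
    ConvexOn ℝ (Icc 0 1) fun v => cdf F v ^ (n - 1) := by
  have hm0 : (0 : ℝ) < (m - 1 : ℕ) := by exact_mod_cast (by omega : 0 < m - 1)
  have hp : (1 : ℝ) ≤ (n - 1 : ℕ) / (m - 1 : ℕ) := by
    rw [one_le_div hm0]; exact_mod_cast (by omega : m - 1 ≤ n - 1)
  have heq : ∀ v, (cdf F v ^ (m - 1)) ^ (((n - 1 : ℕ) : ℝ) / (m - 1 : ℕ)) = cdf F v ^ (n - 1) := by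
    intro v
    rw [← Real.rpow_natCast, ← Real.rpow_mul (cdf_nonneg F v), mul_div_cancel₀ _ hm0.ne',
      Real.rpow_natCast]
  refine ⟨convex_Icc 0 1, fun u hu v hv a b ha hb hab => ?_⟩
  have h0 : ∀ v, 0 ≤ cdf F v ^ (m - 1) := fun v => pow_nonneg (cdf_nonneg F v) _
  have h1 := h.2 hu hv ha hb hab
  have h2 := (convexOn_rpow hp).2 (h0 u) (h0 v) ha hb hab
  simp only [heq] at h2
  refine le_trans ?_ h2
  change cdf F (a • u + b • v) ^ (n - 1) ≤ _
  rw [← heq]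
  exact Real.rpow_le_rpow (h0 _) h1 (by positivity)

/-! ### Contraction and optimality of the disclosure strategy -/

/-- `G` has no mass below `r`, the `(n - 1)`-st power of its distribution function is affine on
`[r, x]`, and it agrees with `F` from the contact point `x` on. Equality of the means is expressed
by the integrals of the distribution functions. -/
structure IsContact (F G : Measure ℝ) (n : ℕ) (r x β : ℝ) : Prop where
  r_pos : 0 < r
  lt : r < x
  le_one : x ≤ 1
  slope_pos : 0 < β
  below : ∀ v ≤ r, cdf G v = 0
  affine : ∀ v ∈ Icc r x, cdf G v ^ (n - 1) = β * (v - r)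
  above : ∀ v, x ≤ v → cdf G v = cdf F v
  mean : ∫ v in (0 : ℝ)..1, cdf G v = ∫ v in (0 : ℝ)..1, cdf F v

/-- The excess of `F ^ (n - 1)` over the line through `(r, 0)` with slope `β`. -/
noncomputable def excess (F : Measure ℝ) (n : ℕ) (r β v : ℝ) : ℝ :=
  cdf F v ^ (n - 1) - β * (v - r)

lemma convexOn_excess {F : Measure ℝ} {n : ℕ} (r β : ℝ)
    (hF : ConvexOn ℝ (Icc 0 1) fun v => cdf F v ^ (n - 1)) :
    ConvexOn ℝ (Icc 0 1) (excess F n r β) := by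
  refine ⟨hF.1, fun u hu v hv a b ha hb hab => ?_⟩
  have h := hF.2 hu hv ha hb hab
  simp only [excess, smul_eq_mul] at h ⊢
  have : β * (a * u + b * v - r) = a * (β * (u - r)) + b * (β * (v - r)) := by
    linear_combination (-β * r) * hab.symm
  linarith

namespace IsContact

variable {F G : Measure ℝ} {n : ℕ} {r x β : ℝ}

lemma excess_self (h : IsContact F G n r x β) : excess F n r β x = 0 := by
  rw [excess, ← h.above x le_rfl, h.affine x ⟨h.lt.le, le_rfl⟩, sub_self]

lemma ae_mem_Ioi (h : IsContact F G n r x β) [IsProbabilityMeasure G] :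
    ∀ᵐ v ∂G, v ∈ Ioi r := by
  rw [ae_iff]
  have : {v | v ∉ Ioi r} = Iic r := by ext v; simp
  rw [this, ← ofReal_cdf, h.below r le_rfl, ENNReal.ofReal_zero]

lemma le_of_excess_nonneg (h : IsContact F G n r x β) (hn : 2 ≤ n) {v : ℝ} (hv : v ∈ Icc r x)
    (he : 0 ≤ excess F n r β v) : cdf G v ≤ cdf F v := by
  rw [excess, ← h.affine v hv, sub_nonneg] at he
  exact (pow_le_pow_iff_left₀ (cdf_nonneg G v) (cdf_nonneg F v) (by omega)).1 he

lemma ge_of_excess_nonpos (h : IsContact F G n r x β) (hn : 2 ≤ n) {v : ℝ} (hv : v ∈ Icc r x)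
    (he : excess F n r β v ≤ 0) : cdf F v ≤ cdf G v := by
  rw [excess, ← h.affine v hv, sub_nonpos] at he
  exact (pow_le_pow_iff_left₀ (cdf_nonneg F v) (cdf_nonneg G v) (by omega)).1 he

/-- By convexity the excess changes sign at most once on `[r, x]`, so that `cdf G` crosses `cdf F`
once, from below; with equal means this is a mean-preserving contraction. -/
lemma isMPC (h : IsContact F G n r x β) [IsProbabilityMeasure F] [IsProbabilityMeasure G]
    (hn : 2 ≤ n) (hF : F (Icc 0 1)ᶜ = 0)
    (hconv : ConvexOn ℝ (Icc 0 1) fun v => cdf F v ^ (n - 1)) : IsMPC G F := by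
  have hr := h.r_pos
  have hrx := h.lt
  have hx1 := h.le_one
  have hle : ∀ z ∈ Icc (0 : ℝ) 1, (∀ v ∈ Icc 0 z, cdf G v ≤ cdf F v) →
      ∫ v in (0 : ℝ)..z, cdf G v ≤ ∫ v in (0 : ℝ)..z, cdf F v := fun z hz hv =>
    intervalIntegral.integral_mono_on hz.1 (intervalIntegrable_cdf G 0 z)
      (intervalIntegrable_cdf F 0 z) hv
  have hge : ∀ z ∈ Icc (0 : ℝ) 1, (∀ v ∈ Icc z 1, cdf F v ≤ cdf G v) →
      ∫ v in (0 : ℝ)..z, cdf G v ≤ ∫ v in (0 : ℝ)..z, cdf F v := by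
    intro z hz hv
    have h0 := intervalIntegral.integral_mono_on hz.2 (intervalIntegrable_cdf F z 1)
      (intervalIntegrable_cdf G z 1) hv
    have h1 := intervalIntegral.integral_add_adjacent_intervals
      (intervalIntegrable_cdf G 0 z) (intervalIntegrable_cdf G z 1)
    have h2 := intervalIntegral.integral_add_adjacent_intervals
      (intervalIntegrable_cdf F 0 z) (intervalIntegrable_cdf F z 1)
    have := h.mean
    linarith
  have he := convexOn_excess r β hconv
  refine ⟨inferInstance, ?_, fun z hz => ?_, h.mean⟩
  · have h1 : ∀ᵐ v ∂G, v ∈ Ioc (0 : ℝ) 1 := by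
      have hG : G (Ioc 0 1) = 1 := by
        rw [← measure_cdf G, StieltjesFunction.measure_Ioc, h.below 0 hr.le, h.above 1 hx1,
          cdf_eq_one_of_one_le hF le_rfl, sub_zero, ENNReal.ofReal_one]
      exact (mem_ae_iff_prob_eq_one measurableSet_Ioc).2 hG
    have h2 : ∀ᵐ v ∂G, v ∈ Icc (0 : ℝ) 1 := h1.mono fun v hv => Ioc_subset_Icc_self hv
    exact h2
  · rcases le_total z r with hzr | hzr
    · refine hle z hz fun v hv => ?_
      rw [h.below v (hv.2.trans hzr)]
      exact cdf_nonneg F v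
    rcases le_total x z with hxz | hzx
    · exact hge z hz fun v hv => (h.above v (hxz.trans hv.1)).ge
    rcases le_or_gt (excess F n r β z) 0 with hez | hez
    · refine hge z hz fun v hv => ?_
      rcases le_total x v with hxv | hvx
      · exact (h.above v hxv).ge
      refine h.ge_of_excess_nonpos hn ⟨hzr.trans hv.1, hvx⟩ ?_
      have := he.le_max_of_mem_Icc hz ⟨by linarith, hx1⟩ (z := v) ⟨hv.1, hvx⟩
      rwa [h.excess_self, max_eq_right hez] at this
    · refine hle z hz fun v hv => ?_
      rcases le_total v r with hvr | hrv
      · rw [h.below v hvr]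
        exact cdf_nonneg F v
      refine h.le_of_excess_nonneg hn ⟨hrv, hv.2.trans hzx⟩ ?_
      by_contra! hev
      have := he.le_max_of_mem_Icc (x := v) (y := x) ⟨hv.1, hv.2.trans hz.2⟩
        ⟨by linarith, hx1⟩ (z := z) ⟨hv.2, hzx⟩
      rw [h.excess_self] at this
      linarith [max_le hev.le (le_refl (0 : ℝ))]

/-- If the line stayed below `F ^ (n - 1)` on all of `[r, x]`, then `G` would have a larger mean
than `F`. So it is above somewhere, and by convexity it is below again from `x` on. -/
lemma excess_nonneg (h : IsContact F G n r x β) [IsProbabilityMeasure F] [IsProbabilityMeasure G]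
    [NullSingletonClass F] [NullSingletonClass G] (hn : 2 ≤ n) (hFr : 0 < cdf F r)
    (hconv : ConvexOn ℝ (Icc 0 1) fun v => cdf F v ^ (n - 1)) {v : ℝ} (hv : v ∈ Icc x 1) :
    0 ≤ excess F n r β v := by
  have hr := h.r_pos
  have hrx := h.lt
  have hx1 := h.le_one
  obtain ⟨y, hy, hey⟩ : ∃ y ∈ Icc r x, excess F n r β y < 0 := by
    by_contra! hcon
    refine (intervalIntegral.integral_lt_integral_of_continuousOn_of_le_of_exists_lt
      (f := cdf G) (g := cdf F) (zero_lt_one' ℝ)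
      (continuous_cdf G).continuousOn (continuous_cdf F).continuousOn ?_
      ⟨r, ⟨hr.le, by linarith⟩, ?_⟩).ne h.mean
    · intro y _
      rcases le_total y r with hyr | hry
      · rw [h.below y hyr]
        exact cdf_nonneg F y
      rcases le_total x y with hxy | hyx
      · exact (h.above y hxy).le
      exact h.le_of_excess_nonneg hn ⟨hry, hyx⟩ (hcon y ⟨hry, hyx⟩)
    · rwa [h.below r le_rfl]
  by_contra! hev
  have := (convexOn_excess r β hconv).le_max_of_mem_Icc (x := y) (y := v)
    ⟨by linarith [hy.1], by linarith [hy.2]⟩ ⟨by linarith [hv.1], hv.2⟩ (z := x) ⟨hy.2, hv.1⟩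
  rw [h.excess_self] at this
  exact absurd (max_lt hey hev) (not_lt.2 this)

lemma convexOn_excess_max (h : IsContact F G n r x β) [IsProbabilityMeasure F]
    [IsProbabilityMeasure G] [NullSingletonClass F] [NullSingletonClass G] (hn : 2 ≤ n)
    (hFr : 0 < cdf F r) (hconv : ConvexOn ℝ (Icc 0 1) fun v => cdf F v ^ (n - 1)) :
    ConvexOn ℝ (Icc 0 1) fun v => excess F n r β (max v x) := by
  have hx0 : 0 ≤ x := h.r_pos.le.trans h.lt.le
  have hx1 := h.le_one
  have he := convexOn_excess r β hconv
  have hmono : ∀ u v, x ≤ u → u ≤ v → v ≤ 1 → excess F n r β u ≤ excess F n r β v := by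
    intro u v hu huv hv
    have := he.le_max_of_mem_Icc (x := x) (y := v) ⟨hx0, hx1⟩
      ⟨by linarith, hv⟩ (z := u) ⟨hu, huv⟩
    rwa [h.excess_self, max_eq_right (h.excess_nonneg hn hFr hconv ⟨hu.trans huv, hv⟩)] at this
  refine ⟨convex_Icc 0 1, fun u hu v hv a b ha hb hab => ?_⟩
  have hmem : ∀ u ∈ Icc (0 : ℝ) 1, max u x ∈ Icc (0 : ℝ) 1 := fun u hu =>
    ⟨hu.1.trans (le_max_left _ _), max_le hu.2 hx1⟩
  refine le_trans (hmono _ _ (le_max_right _ _) ?_ ?_)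
    (he.2 (hmem u hu) (hmem v hv) ha hb hab)
  · exact (convexOn_id convex_univ |>.sup (convexOn_const x convex_univ)).2
      (mem_univ u) (mem_univ v) ha hb hab
  · exact ((convex_Icc (0 : ℝ) 1) (hmem u hu) (hmem v hv) ha hb hab).2

/-- Optimality of `G` by a price function `p ≥ u`, convex, equal to `u` on the support of `G`, and
affine except where `F` and `G` agree:
`∫ u dH ≤ ∫ p dH ≤ ∫ p dF = ∫ p dG = ∫ u dG`. -/
lemma integral_le (h : IsContact F G n r x β) [IsProbabilityMeasure F]
    [IsProbabilityMeasure G] [NullSingletonClass F] [NullSingletonClass G] (hn : 2 ≤ n)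
    (hF : F (Icc 0 1)ᶜ = 0) (hFr : 0 < cdf F r)
    (hconv : ConvexOn ℝ (Icc 0 1) fun v => cdf F v ^ (n - 1)) {b : ℝ} (hb0 : 0 ≤ b) (hb1 : b ≤ 1)
    {κ : ℝ → ℝ} (hκ1 : ∀ v, κ v ≤ 1) (hκr : ∀ v, r ≤ v → κ v = 0)
    (hκ : ∀ v ∈ Icc 0 r, (1 - b) * β * (r - v) ≤ b * κ v) {H : Measure ℝ} (hH : IsMPC H F) :
    ∫ v, (b * (1 - κ v) + (1 - b) * cdf G v ^ (n - 1)) ∂H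
      ≤ ∫ v, (b * (1 - κ v) + (1 - b) * cdf G v ^ (n - 1)) ∂G := by
  have hHp := hH.1
  have hG := h.isMPC hn hF hconv
  set ψ : ℝ → ℝ := fun v => excess F n r β (max v x) with hψ
  set p : ℝ → ℝ := fun v => b + (1 - b) * (β * (v - r) + ψ v) with hp
  have hψc : Continuous ψ := by
    have := continuous_cdf F
    simp only [hψ, excess]
    fun_prop
  have hψ0 : ∀ v ≤ x, ψ v = 0 := fun v hv => by simp only [hψ]; rw [max_eq_right hv, h.excess_self]
  have hpc : Continuous p := by fun_prop
  have hpu : ∀ v, r ≤ v → b * (1 - κ v) + (1 - b) * cdf G v ^ (n - 1) = p v := by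
    intro v hv
    simp only [hp]
    rcases le_total v x with hvx | hxv
    · rw [hκr v hv, h.affine v ⟨hv, hvx⟩, hψ0 v hvx]; ring
    · simp only [hψ]
      rw [hκr v hv, h.above v hxv, max_eq_left hxv, excess]; ring
  have hup : ∀ v ∈ Icc (0 : ℝ) 1, b * (1 - κ v) + (1 - b) * cdf G v ^ (n - 1) ≤ p v := by
    intro v hv
    rcases le_total r v with hrv | hvr
    · exact (hpu v hrv).le
    · have := hκ v ⟨hv.1, hvr⟩
      simp only [hp]
      rw [hψ0 v (hvr.trans h.lt.le), h.below v hvr, zero_pow (by omega)]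
      linarith
  have hint : ∀ {P : Measure ℝ}, IsMPC P F →
      ∫ v, p v ∂P = b + (1 - b) * (β * (∫ v, v ∂F - r) + ∫ v, ψ v ∂P) := by
    intro P hP
    have hPp := hP.1
    have h01 := hP.2.1
    have hi : ∀ {f : ℝ → ℝ}, Continuous f → Integrable f P := fun hf =>
      integrable_of_continuousOn h01 hf.continuousOn
    simp only [hp]
    rw [integral_add (hi (by fun_prop)) (hi (by fun_prop)), integral_const_mul (1 - b),
      integral_add (hi (by fun_prop)) (hi hψc), integral_const_mul β,
      integral_sub (hi (by fun_prop)) (hi (by fun_prop)), hP.integral_id_eq hF]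
    simp
  have h1 : ∫ v, (b * (1 - κ v) + (1 - b) * cdf G v ^ (n - 1)) ∂H ≤ ∫ v, p v ∂H := by
    have hae : ∀ᵐ v ∂H, v ∈ Icc (0 : ℝ) 1 := hH.2.1
    refine integral_mono_of_nonneg (ae_of_all _ fun v => ?_)
      (integrable_of_continuousOn hH.2.1 hpc.continuousOn) ?_
    · have h2 := hκ1 v
      have h3 := pow_nonneg (cdf_nonneg G v) (n - 1)
      have h4 : 0 ≤ b * (1 - κ v) := mul_nonneg hb0 (by linarith)
      have h5 : 0 ≤ (1 - b) * cdf G v ^ (n - 1) := mul_nonneg (by linarith) h3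
      exact add_nonneg h4 h5
    · filter_upwards [hae] with v hv using hup v hv
  have h2 : ∫ v, (b * (1 - κ v) + (1 - b) * cdf G v ^ (n - 1)) ∂G = ∫ v, p v ∂G := by
    refine integral_congr_ae ?_
    filter_upwards [h.ae_mem_Ioi] with v hv using hpu v (le_of_lt hv)
  rw [h2]
  refine h1.trans ?_
  rw [hint hH, hint hG, integral_eq_of_cdf_eq h.above hψ0]
  have := hH.integral_le_of_convexOn hF (h.convexOn_excess_max hn hFr hconv) hψc.continuousOn
  have hb : 0 ≤ 1 - b := by linarith
  gcongr

end IsContact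

/-! ### The prior -/

namespace IsPrior

variable {F : Measure ℝ}

lemma nullSingletonClass (hF : IsPrior F) : NullSingletonClass F := by
  obtain ⟨f, -, rfl⟩ := hF.density
  exact ⟨fun v => withDensity_absolutelyContinuous _ _ (measure_singleton v)⟩

lemma compl_Icc (hF : IsPrior F) : F (Icc 0 1)ᶜ = 0 := by
  rw [← hF.support_eq]
  exact Measure.measure_compl_support

lemma measure_pos (hF : IsPrior F) {U : Set ℝ} (hU : IsOpen U) {v : ℝ} (hv : v ∈ U)
    (hv1 : v ∈ Icc (0 : ℝ) 1) : 0 < F U := by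
  rw [← hF.support_eq] at hv1
  exact (Measure.mem_support_iff_forall v).1 hv1 U (hU.mem_nhds hv)

lemma cdf_pos (hF : IsPrior F) {v : ℝ} (hv : 0 < v) : 0 < cdf F v := by
  have := hF.prob
  have h := hF.measure_pos isOpen_Iio (mem_Iio.2 hv) (by simp)
  rw [cdf_eq_real]
  exact ENNReal.toReal_pos (h.trans_le (measure_mono Iio_subset_Iic_self)).ne' (measure_ne_top _ _)

lemma cdf_lt_one (hF : IsPrior F) {v : ℝ} (hv : v < 1) : cdf F v < 1 := by
  have := hF.prob
  have h := hF.measure_pos isOpen_Ioi (mem_Ioi.2 hv) (by simp)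
  have h1 : 0 < F.real (Ioi v) := ENNReal.toReal_pos h.ne' (measure_ne_top _ _)
  rw [← compl_Iic, probReal_compl_eq_one_sub measurableSet_Iic] at h1
  rw [cdf_eq_real]
  linarith

lemma cdf_zero (hF : IsPrior F) : cdf F 0 = 0 := by
  have := hF.prob
  have := hF.nullSingletonClass
  rw [cdf_eq_real, measureReal_congr Iio_ae_eq_Iic.symm, measureReal_def,
    measure_mono_null _ hF.compl_Icc, ENNReal.toReal_zero]
  intro v hv hv'
  exact absurd hv'.1 (not_le.2 hv)

end IsPrior

/-! ### Search costs near the lowest cost -/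

lemma IsDiscreteCost.exists_mul_le {K : Measure ℝ} [IsProbabilityMeasure K] {s₁ : ℝ}
    (h : IsDiscreteCost K s₁) {r : ℝ} (hr : 0 < r) :
    ∃ c > 0, ∀ y ∈ Icc 0 r, c * y ≤ K.real (Iio (s₁ + y)) := by
  have hpos : 0 < K.real {s₁} := by
    refine ENNReal.toReal_pos (fun h0 => ?_) (measure_ne_top _ _)
    have hfin : (K.support \ {s₁}).Finite := h.1.subset sdiff_subset
    have hU : (K.support \ {s₁})ᶜ ∈ nhds s₁ := hfin.isClosed.isOpen_compl.mem_nhds (by simp)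
    refine ((Measure.mem_support_iff_forall s₁).1 h.2.1 _ hU).ne' ?_
    refine measure_mono_null (t := K.supportᶜ ∪ {s₁}) (fun s hs => ?_)
      (measure_union_null Measure.measure_compl_support h0)
    by_cases h1 : s = s₁
    · exact Or.inr h1
    · exact Or.inl fun h2 => hs ⟨h2, h1⟩
  refine ⟨K.real {s₁} / r, by positivity, fun y hy => ?_⟩
  rcases hy.1.eq_or_lt with rfl | hy0
  · simp
  calc K.real {s₁} / r * y ≤ K.real {s₁} / r * r := by gcongr; exact hy.2
    _ = K.real {s₁} := div_mul_cancel₀ _ hr.ne'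
    _ ≤ K.real (Iio (s₁ + y)) :=
        measureReal_mono (singleton_subset_iff.2 (by simpa using hy0))

lemma IsContinuousCost.exists_mul_le {K : Measure ℝ} [IsProbabilityMeasure K] {s₁ : ℝ}
    (h : IsContinuousCost K s₁) {r : ℝ} (hr : 0 < r) :
    ∃ c > 0, ∀ y ∈ Icc 0 r, c * y ≤ K.real (Iio (s₁ + y)) := by
  obtain ⟨k, sk, -, hdens, hsk, hsupp, hder, hk⟩ := h
  have hna : NullSingletonClass K := by
    rw [hdens]; exact ⟨fun v => withDensity_absolutelyContinuous _ _ (measure_singleton v)⟩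
  have hcdf : ∀ s, K.real (Iio s) = cdf K s := fun s => by
    rw [cdf_eq_real, measureReal_congr Iio_ae_eq_Iic]
  have h0 : cdf K s₁ = 0 := by
    rw [← hcdf, measureReal_def, measure_mono_null _ (Measure.measure_compl_support (μ := K)),
      ENNReal.toReal_zero]
    intro s hs hs'
    rw [hsupp] at hs'
    exact absurd hs'.1 (not_le.2 hs)
  have hk' : (0 : ℝ) < k s₁ := hk
  rw [hasDerivWithinAt_iff_tendsto_slope] at hder
  have hev := hder.eventually (lt_mem_nhds (half_lt_self hk'))
  rw [show Ici s₁ \ {s₁} = Ioi s₁ from Ici_sdiff_left, eventually_nhdsWithin_iff,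
    Metric.eventually_nhds_iff] at hev
  obtain ⟨δ, hδ, hev⟩ := hev
  -- The distribution function has slope at least `k s₁ / 2` up to `s₁ + ε`.
  set ε := min (δ / 2) r with hε
  have hε0 : 0 < ε := lt_min (by positivity) hr
  have hεr : ε ≤ r := min_le_right _ _
  have hsmall : ∀ y, 0 < y → y ≤ ε → (k s₁ : ℝ) / 2 * y ≤ cdf K (s₁ + y) := by
    intro y hy0 hy
    have hyδ : y < δ := by linarith [min_le_left (δ / 2) r]
    have := hev (y := s₁ + y) (by simpa [abs_of_pos hy0] using hyδ) (by simpa using hy0)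
    rw [slope_def_field, h0, sub_zero, add_sub_cancel_left, lt_div_iff₀ hy0] at this
    exact this.le
  refine ⟨(k s₁ : ℝ) / 2 * (ε / r), by positivity, fun y hy => ?_⟩
  rw [hcdf]
  rcases hy.1.eq_or_lt with rfl | hy0
  · simp [h0]
  rcases le_total y ε with hyε | hyε
  · refine le_trans ?_ (hsmall y hy0 hyε)
    have : ε / r ≤ 1 := (div_le_one hr).2 hεr
    have : (k s₁ : ℝ) / 2 * (ε / r) ≤ (k s₁ : ℝ) / 2 * 1 := by gcongr
    rw [mul_one] at this
    gcongr
  · calc (k s₁ : ℝ) / 2 * (ε / r) * y ≤ (k s₁ : ℝ) / 2 * (ε / r) * r := by gcongr; exact hy.2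
      _ = (k s₁ : ℝ) / 2 * ε := by field_simp
      _ ≤ cdf K (s₁ + ε) := hsmall ε hε0 le_rfl
      _ ≤ cdf K (s₁ + y) := monotone_cdf K (by linarith)

lemma isLeast_support {K : Measure ℝ} {s₁ : ℝ}
    (h : IsDiscreteCost K s₁ ∨ IsContinuousCost K s₁) : IsLeast K.support s₁ := by
  rcases h with h | ⟨k, sk, -, -, hsk, hsupp, -, -⟩
  · exact h.2
  · rw [hsupp]; exact isLeast_Icc hsk.le

/-! ### The contact point -/

section Contact

variable {F : Measure ℝ} [IsProbabilityMeasure F] [NullSingletonClass F] {r : ℝ}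

/-- The condition for equal means with infinitely many firms holds with slack at some point below
`1`, because the mean of the prior exceeds `r`. -/
lemma exists_lt_one_integral_lt (hr1 : r < 1)
    (hmean : ∫ v in (0 : ℝ)..1, cdf F v < cdf F 1 * (1 - r)) :
    ∃ x₀ ∈ Ioo r 1, ∫ v in (0 : ℝ)..x₀, cdf F v < cdf F x₀ * (x₀ - r) := by
  have hcF := continuous_cdf F
  have hI : Continuous fun x => ∫ v in (0 : ℝ)..x, cdf F v :=
    intervalIntegral.continuous_primitive (fun a b => intervalIntegrable_cdf F a b) 0
  have hev : ∀ᶠ x in nhds (1 : ℝ), ∫ v in (0 : ℝ)..x, cdf F v < cdf F x * (x - r) :=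
    hI.continuousAt.eventually_lt (by fun_prop : Continuous fun x => cdf F x * (x - r)).continuousAt
      hmean
  obtain ⟨x, hx, hx'⟩ := ((hev.filter_mono nhdsWithin_le_nhds).and
    (Ioo_mem_nhdsLT hr1)).exists
  exact ⟨x, hx', hx⟩

/-- The contact point is found by the intermediate value theorem; it stays away from `r`. -/
lemma exists_contact {n : ℕ} (hn : 2 ≤ n) {x₀ : ℝ} (hx₀ : x₀ ∈ Ioo r 1)
    (hA : 0 < ∫ v in (0 : ℝ)..r, cdf F v)
    (h : ∫ v in (0 : ℝ)..x₀, cdf F v ≤ cdf F x₀ * (x₀ - r) * (((n : ℝ) - 1) / n)) :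
    ∃ x ∈ Ioc r x₀, ∫ v in (0 : ℝ)..r, cdf F v ≤ x - r ∧
      ∫ v in (0 : ℝ)..x, cdf F v = cdf F x * (x - r) * (((n : ℝ) - 1) / n) := by
  have hn' := sub_one_pos_of_two_le hn
  have hcF := continuous_cdf F
  have hI : Continuous fun x => ∫ v in (0 : ℝ)..x, cdf F v :=
    intervalIntegral.continuous_primitive (fun a b => intervalIntegrable_cdf F a b) 0
  set D : ℝ → ℝ := fun x =>
    cdf F x * (x - r) * (((n : ℝ) - 1) / n) - ∫ v in (0 : ℝ)..x, cdf F v with hD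
  have hDc : Continuous D := by fun_prop
  have h0 : D r < 0 := by simp only [hD, sub_self, mul_zero, zero_mul, zero_sub]; linarith
  obtain ⟨x, hx, hDx⟩ := intermediate_value_Icc hx₀.1.le hDc.continuousOn
    (show (0 : ℝ) ∈ Icc (D r) (D x₀) from ⟨h0.le, sub_nonneg.2 h⟩)
  have hrx : r < x := lt_of_le_of_ne hx.1 fun h' => by rw [← h'] at hDx; linarith
  have heq := (sub_eq_zero.1 hDx).symm
  refine ⟨x, ⟨hrx, hx.2⟩, ?_, heq⟩
  have h1 : ∫ v in (0 : ℝ)..r, cdf F v ≤ ∫ v in (0 : ℝ)..x, cdf F v := by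
    have := intervalIntegral.integral_add_adjacent_intervals
      (intervalIntegrable_cdf F 0 r) (intervalIntegrable_cdf F r x)
    have := intervalIntegral.integral_nonneg (μ := volume) hrx.le
      (fun v _ => cdf_nonneg F v)
    linarith
  rw [heq] at h1
  refine h1.trans ?_
  have h2 : ((n : ℝ) - 1) / n ≤ 1 := by rw [div_le_one (by linarith)]; linarith
  have h3 : 0 ≤ x - r := by linarith
  have h4 : 0 ≤ ((n : ℝ) - 1) / n := div_nonneg hn'.le (by linarith)
  calc cdf F x * (x - r) * (((n : ℝ) - 1) / n) ≤ 1 * (x - r) * 1 := by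
        gcongr
        exact cdf_le_one F x
    _ = x - r := by ring

lemma exists_isContact {n : ℕ} (hn : 2 ≤ n) (hF : F (Icc 0 1)ᶜ = 0) (hr : 0 < r) {x : ℝ}
    (hrx : r < x) (hx1 : x ≤ 1) (hFx : 0 < cdf F x)
    (heq : ∫ v in (0 : ℝ)..x, cdf F v = cdf F x * (x - r) * (((n : ℝ) - 1) / n)) :
    ∃ G : Measure ℝ, IsProbabilityMeasure G ∧ NullSingletonClass G ∧
      (∀ v ∈ Icc r x,
        cdf G v = (cdf F x ^ (n - 1) / (x - r) * (v - r)) ^ (1 / ((n : ℝ) - 1))) ∧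
      IsContact F G n r x (cdf F x ^ (n - 1) / (x - r)) := by
  obtain ⟨G, hGp, hGn, hG⟩ := exists_measure_cdf_eq (monotone_disclosureFun (F := F) hn hrx)
    (continuous_disclosureFun hn hrx) (a := r) (b := 1)
    (fun v hv => disclosureFun_of_le hn hrx hv)
    (fun v hv => by
      rw [disclosureFun_of_ge hrx (hx1.trans hv), cdf_eq_one_of_one_le hF hv])
  have hxr : 0 < x - r := by linarith
  have haff : ∀ v ∈ Icc r x,
      cdf G v = (cdf F x ^ (n - 1) / (x - r) * (v - r)) ^ (1 / ((n : ℝ) - 1)) := fun v hv => by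
    rw [hG, disclosureFun_eq_rpow hn hrx hv]
  refine ⟨G, hGp, hGn, haff, hr, hrx, hx1, by positivity, fun v hv => ?_, fun v hv => ?_,
    fun v hv => ?_, ?_⟩
  · rw [hG, disclosureFun_of_le hn hrx hv]
  · have h1 : 0 ≤ cdf F x ^ (n - 1) / (x - r) * (v - r) :=
      mul_nonneg (by positivity) (by linarith [hv.1])
    have hcast : ((n - 1 : ℕ) : ℝ) = (n : ℝ) - 1 := by
      rw [Nat.cast_sub (by omega), Nat.cast_one]
    rw [haff v hv, one_div, ← hcast, Real.rpow_inv_natCast_pow h1 (by omega)]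
  · rw [hG, disclosureFun_of_ge hrx hv]
  · simp only [hG]
    rw [integral_disclosureFun hn hr.le hrx hx1, ← heq]
    exact intervalIntegral.integral_add_adjacent_intervals
      (intervalIntegrable_cdf F 0 x) (intervalIntegrable_cdf F x 1)

end Contact

/-! ### The equilibrium -/

namespace IsContact

variable {F G K : Measure ℝ} {n : ℕ} {r x β m s₁ α c : ℝ}

lemma hasDisclosureShape (h : IsContact F G n r x β) (hn : 2 ≤ n) (hF0 : cdf F 0 = 0)
    (haff : ∀ v ∈ Icc r x, cdf G v = (β * (v - r)) ^ (1 / ((n : ℝ) - 1))) :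
    HasDisclosureShape F G n r 0 x β where
  slope_pos := h.slope_pos
  lower_mem := ⟨le_rfl, h.r_pos⟩
  upper_mem := ⟨h.lt, h.le_one⟩
  contact := h.above x le_rfl
  below v hv := by
    obtain rfl : v = 0 := le_antisymm hv.2 hv.1
    rw [h.below 0 h.r_pos.le, hF0]
  gap v hv := by rw [h.below v hv.2.le, hF0]
  affine v hv := by
    rw [hF0, zero_pow (by omega), zero_add, haff v hv, min_eq_left]
    rw [← h.affine v hv]
    exact pow_le_one₀ (cdf_nonneg G v) (cdf_le_one G v)
  above v hv := h.above v hv.1.le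

lemma ae_mem_Icc (h : IsContact F G n r x β) [IsProbabilityMeasure G]
    (hG : G (Icc 0 1)ᶜ = 0) : ∀ᵐ v ∂G, v ∈ Icc r 1 := by
  have h1 : ∀ᵐ v ∂G, v ∈ Icc (0 : ℝ) 1 := hG
  filter_upwards [h1, h.ae_mem_Ioi] with v hv hv' using ⟨le_of_lt hv', hv.2⟩

/-- As `G` has no mass below `r`, the reservation value is the mean minus the cost. -/
lemma isReservationValue [IsProbabilityMeasure G] (hG1 : G (Icc 0 1)ᶜ = 0)
    (hG : ∀ᵐ v ∂G, v ∈ Icc r 1) (hm : ∫ v, v ∂G = s₁ + r) : IsReservationValue G s₁ r := by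
  rw [IsReservationValue, Measure.restrict_eq_self_of_ae_mem hG,
    integral_sub (integrable_of_continuousOn hG1 (by fun_prop)) (integrable_const _), hm]
  simp

/-- Let `b` be the belief that a visitor is inexperienced. At `v < r` the affine price function lies
`(1 - b) β (r - v)` below its value `b` at `r`, while the payoff lies at least `b c (r - v)` below
it, because the types with reservation value above `v` leave. As `b` is at least of order `1 / n`,
the price stays above the payoff once `β` is small compared with `1 / n`. -/
lemma isEquilibrium (h : IsContact F G n r x β) [IsProbabilityMeasure F]
    [IsProbabilityMeasure G] [IsProbabilityMeasure K] [NullSingletonClass F]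
    [NullSingletonClass G] (hn : 2 ≤ n) (hF : F (Icc 0 1)ᶜ = 0) (hFr : 0 < cdf F r)
    (hconv : ConvexOn ℝ (Icc 0 1) fun v => cdf F v ^ (n - 1)) (hm : ∫ v, v ∂F = s₁ + r)
    (hs₁ : 0 ≤ s₁) (hK : ∀ s ∈ K.support, s₁ ≤ s) (hα₀ : 0 < α) (hα₁ : α ≤ 1)
    (hc : ∀ y ∈ Icc 0 r, c * y ≤ K.real (Iio (s₁ + y))) (hβ : n * β ≤ α * c) :
    IsEquilibrium n F α K G (cutoffRule (s₁ + r)) := by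
  have hMPC := h.isMPC hn hF hconv
  have hG := h.ae_mem_Icc hMPC.2.1
  have hKae : ∀ᵐ s ∂K, s₁ ≤ s := by
    filter_upwards [Measure.support_mem_ae (μ := K)] with s hs using hK s hs
  have hKr : ∀ᵐ s ∂K, s₁ + r ≤ s + r := hKae.mono fun s hs => by gcongr
  have hn0 : (0 : ℝ) < n := by
    have := sub_one_pos_of_two_le hn
    linarith
  have heta : eta n K G (cutoffRule (s₁ + r)) = 1 / n := eta_cutoffRule (by omega) hG hKr
  set b := belief n α K G (cutoffRule (s₁ + r)) with hb
  have hbval : b = α / (α + n * (1 - α)) := by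
    rw [hb, belief, heta]
    field_simp
  have hden : 0 < α + n * (1 - α) := add_pos_of_pos_of_nonneg hα₀
    (mul_nonneg hn0.le (by linarith))
  have h1b : 1 - b = n * (1 - α) / (α + n * (1 - α)) := by
    rw [hbval]
    field_simp
    ring
  have hb0 : 0 ≤ b := by rw [hbval]; positivity
  have hb1 : b ≤ 1 := by
    have : 0 ≤ 1 - b := by
      rw [h1b]; exact div_nonneg (mul_nonneg hn0.le (by linarith)) hden.le
    linarith
  refine ⟨measurableSet_cutoffRule _, fun s hs => ?_, hMPC, fun H hH => ?_⟩
  · have hs' := hK s hs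
    exact isOptimalSearch_cutoffRule hG (by rw [hMPC.integral_id_eq hF, hm]) (by linarith)
      (by linarith) n
  · have hpay : ∀ v, firmPayoff n α K G (cutoffRule (s₁ + r)) v
        = b * (1 - K.real (Iio (s₁ + r - v))) + (1 - b) * cdf G v ^ (n - 1) := fun v =>
      firmPayoff_cutoffRule hn hG hKr α v
    simp only [hpay]
    refine h.integral_le hn hF hFr hconv hb0 hb1 (κ := fun v => K.real (Iio (s₁ + r - v)))
      (fun v => measureReal_le_one) (fun v hv => ?_) (fun v hv => ?_) hH
    · have hz : K (Iio (s₁ + r - v)) = 0 := by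
        refine measure_mono_null (fun s hs => ?_) (ae_iff.1 hKae)
        have : s < s₁ + r - v := hs
        simp only [mem_ofPred_eq, not_le]
        linarith
      simp only [measureReal_def, hz, ENNReal.toReal_zero]
    · have hcv := hc (r - v) ⟨by linarith [hv.2], by linarith [hv.1]⟩
      rw [← add_sub_assoc] at hcv
      have hslope : (1 - b) * β ≤ b * c := by
        rw [h1b, hbval, div_mul_eq_mul_div, div_mul_eq_mul_div]
        refine div_le_div_of_nonneg_right ?_ hden.le
        have : n * (1 - α) * β ≤ n * β := by
          have := mul_pos hn0 h.slope_pos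
          nlinarith
        linarith
      calc (1 - b) * β * (r - v) ≤ b * c * (r - v) :=
            mul_le_mul_of_nonneg_right hslope (by linarith [hv.2])
        _ = b * (c * (r - v)) := by ring
        _ ≤ b * K.real (Iio (s₁ + r - v)) := mul_le_mul_of_nonneg_left hcv hb0

end IsContact

end SearchMarket

theorem proposition6 (F : Measure ℝ) (hF : SearchMarket.IsPrior F)
    (α : ℝ) (hα₀ : 0 < α) (hα₁ : α ≤ 1)
    (K : Measure ℝ) (hK : IsProbabilityMeasure K)
    (s₁ : ℝ) (hs₀ : 0 < s₁) (hs₁ : s₁ < ∫ v, v ∂F)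
    (hcost : SearchMarket.IsDiscreteCost K s₁ ∨ SearchMarket.IsContinuousCost K s₁) :
    ∃ N : ℕ, ∀ n : ℕ, N < n →
      ∃ (G : Measure ℝ) (σ : ℝ → SearchMarket.StoppingRule) (r : ℝ),
        SearchMarket.IsEquilibrium n F α K G σ ∧
        SearchMarket.IsReservationValue G s₁ r ∧
        SearchMarket.NoDisclosureAtBottom F G n r := by
  open SearchMarket in
  have := hF.prob
  have := hF.nullSingletonClass
  have hF01 := hF.compl_Icc
  obtain ⟨m, hm2, hmconv⟩ := hF.convex_pow
  -- The distribution has no mass below the reservation value `r` and mean `r + s₁`.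
  obtain ⟨r, hr⟩ : ∃ r, ∫ v, v ∂F = s₁ + r := ⟨∫ v, v ∂F - s₁, by ring⟩
  have hr0 : 0 < r := by linarith
  have hmean := integral_id_eq_one_sub hF01
  have hint0 : 0 ≤ ∫ v in (0 : ℝ)..1, cdf F v :=
    intervalIntegral.integral_nonneg zero_le_one fun v _ => cdf_nonneg F v
  have hA : 0 < ∫ v in (0 : ℝ)..r, cdf F v :=
    intervalIntegral.intervalIntegral_pos_of_pos_on (intervalIntegrable_cdf F 0 r)
      (fun v hv => hF.cdf_pos hv.1) hr0
  obtain ⟨x₀, hx₀, hlt⟩ := exists_lt_one_integral_lt (F := F) (r := r) (by linarith)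
    (by rw [cdf_eq_one_of_one_le hF01 le_rfl]; linarith)
  obtain ⟨c, hc0, hc⟩ : ∃ c > 0, ∀ y ∈ Icc 0 r, c * y ≤ K.real (Iio (s₁ + y)) :=
    hcost.elim (fun h => h.exists_mul_le hr0) (fun h => h.exists_mul_le hr0)
  -- The slope is at most `F(x₀) ^ (n - 1)` up to a constant, hence `o(1 / n)`.
  have hlim1 : ∀ᶠ n : ℕ in Filter.atTop, ∫ v in (0 : ℝ)..x₀, cdf F v
      ≤ cdf F x₀ * (x₀ - r) * (((n : ℝ) - 1) / n) := by
    have ht : Filter.Tendsto (fun n : ℕ => ((n : ℝ) - 1) / n) Filter.atTop (nhds 1) := by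
      have := (tendsto_const_nhds (x := (1 : ℝ))).sub
        (tendsto_inv_atTop_nhds_zero_nat (𝕜 := ℝ))
      rw [sub_zero] at this
      refine this.congr' ?_
      filter_upwards [Filter.eventually_gt_atTop 0] with n hn
      have : (n : ℝ) ≠ 0 := by positivity
      field_simp
    have ht' := ht.const_mul (cdf F x₀ * (x₀ - r))
    rw [mul_one] at ht'
    exact (ht'.eventually (lt_mem_nhds hlt)).mono fun n hn => hn.le
  have hlim2 : ∀ᶠ n : ℕ in Filter.atTop, n * cdf F x₀ ^ n
      ≤ α * c * (∫ v in (0 : ℝ)..r, cdf F v) * cdf F x₀ := by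
    have hpos : 0 < α * c * (∫ v in (0 : ℝ)..r, cdf F v) * cdf F x₀ :=
      mul_pos (by positivity) (hF.cdf_pos (hr0.trans hx₀.1))
    exact ((tendsto_self_mul_const_pow_of_lt_one (cdf_nonneg F x₀)
      (hF.cdf_lt_one hx₀.2)).eventually (gt_mem_nhds hpos)).mono fun n hn => hn.le
  obtain ⟨N, hN⟩ := Filter.eventually_atTop.1 (hlim1.and hlim2)
  refine ⟨max N m, fun n hn => ?_⟩
  have hNn : N ≤ n := (le_max_left N m).trans hn.le
  have hmn : m ≤ n := (le_max_right N m).trans hn.le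
  have hn2 : 2 ≤ n := hm2.trans hmn
  obtain ⟨h1, h2⟩ := hN n hNn
  obtain ⟨x, hx, hAx, hxeq⟩ := exists_contact hn2 hx₀ hA h1
  have hx1 : x ≤ 1 := hx.2.trans hx₀.2.le
  have hconv := convexOn_cdf_pow_of_le hm2 hmn hmconv
  obtain ⟨G, hGp, hGn, haff, hG⟩ :=
    exists_isContact hn2 hF01 hr0 hx.1 hx1 (hF.cdf_pos (hr0.trans hx.1)) hxeq
  have hslope : n * (cdf F x ^ (n - 1) / (x - r)) ≤ α * c := by
    have hq := hF.cdf_pos (hr0.trans hx₀.1)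
    have h3 : n * cdf F x₀ ^ (n - 1) ≤ α * c * ∫ v in (0 : ℝ)..r, cdf F v := by
      refine le_of_mul_le_mul_right ?_ hq
      rwa [mul_assoc, ← pow_succ, Nat.sub_add_cancel (by omega)]
    have h4 : cdf F x ^ (n - 1) ≤ cdf F x₀ ^ (n - 1) :=
      pow_le_pow_left₀ (cdf_nonneg F x) (monotone_cdf F hx.2) _
    rw [← mul_div_assoc, div_le_iff₀ (by linarith [hx.1])]
    calc n * cdf F x ^ (n - 1) ≤ n * cdf F x₀ ^ (n - 1) := by gcongr
      _ ≤ α * c * ∫ v in (0 : ℝ)..r, cdf F v := h3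
      _ ≤ α * c * (x - r) := by gcongr
  have hMPC := hG.isMPC hn2 hF01 hconv
  have hleast := isLeast_support hcost
  exact ⟨G, cutoffRule (s₁ + r), r,
    hG.isEquilibrium hn2 hF01 (hF.cdf_pos hr0) hconv hr hs₀.le (fun s hs => hleast.2 hs)
      hα₀ hα₁ hc hslope,
    IsContact.isReservationValue hMPC.2.1 (hG.ae_mem_Icc hMPC.2.1)
      (by rw [hMPC.integral_id_eq hF01, hr]),
    x, _, hG.hasDisclosureShape hn2 hF.cdf_zero haff⟩
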